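/- Let $p>5$ be a prime. For a set $A\subset\,]0,p[$ of real numbers and an integer $n\ge 1$, the sum $\sum_{j\in A}1/j^{n}$ runs over the integers $j\in A$; it is a rational number whose denominator is prime to $p$, and divisibility and congruences modulo $p$ are understood in that sense. For $d\ge 1$ and $1\le l\le d$ let $[\frac{lp}{d+1},\frac{lp}{d}[$ be the half-open real interval, and say that the first case of Fermat's Last Theorem (FLT) holds for $p$ if there are no $x,y,z\in\mathbb Z$ with $x^p+y^p+z^p=0$ and $p\nmid xyz$. (1) Let $\mu\in\{3,5,7\}$ and $1\le d_1<d_2\le p-2$. Then, modulo $p$, $$\sum_{l=1}^{d_1}\sum_{m=1}^{d_2}\ \sum_{j\in[\frac{lp}{d_1+1},\frac{lp}{d_1}[\,\cap\,[\frac{mp}{d_2+1},\frac{mp}{d_2}[}\frac1{j^\mu}\;=\;\sum_{j\in\bigcup_{l=1}^{d_1}\bigcup_{m=1}^{d_2}\left([\frac{lp}{d_1+1},\frac{lp}{d_1}[\,\cap\,[\frac{mp}{d_2+1},\frac{mp}{d_2}[\right)}\frac1{j^\mu},$$ and if $p$ does not divide this sum, then the first case of FLT holds for $p$. (2) Let $\mu\in\{3,5,7\}$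 and $1\le d\le p-2$. If $p$ does not divide $$\sum_{j\in\bigcup_{l=1}^{d}[\frac{lp}{d+1},\frac{lp}{d}[}\frac1{j^\mu},$$ then the first case of FLT holds for $p$. For $d=1$, $\mu=3$ this sum is congruent modulo $p$ to $-\sum_{j=1}^{(p-1)/2}1/j^3$, so that (2) generalises Cauchy's criterion. (3) For $1\le m\le\frac{p-3}2$ let $\phi_{2m+1}(T)=\sum_{i=1}^{p-1}i^{2m}T^i$, let $C_M(t)=\{m : 1\le m\le \frac{p-3}{2},\ \phi_{2m+1}(t)\not\equiv0 \bmod p\}$, and let $r_p$ be the $p$-rank of the class group of $\mathbb Q(\zeta_p)$. Suppose that the first case of FLT fails for $p$, and let $x,y,z\in\mathbb Z$ be any solution of $x^p+y^p+z^p=0$ with $p\nmid xyz$. (a) If $x\not\equiv y \bmod p$ and $t\equiv -x/y \bmod p$, then $1\in C_M(t)$ and $3\le \mathrm{Card}\,C_M(t)\le r_p$, and for every $m\in C_M(t)$ and every $1\le d\le p-2$ $$\sum_{j\in\bigcup_{l=1}^{d}[\frac{lp}{d+1},\frac{lp}{d}[}\frac1{j^{2m+1}}\equiv0\pmod p.$$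 (b) There is a permutation $(x',y',z')$ of $(x,y,z)$ with $x'\not\equiv y' \bmod p$ such that $\{1,2,3\}\subset C_M(t')$ for $t'\equiv -x'/y' \bmod p$. -/

import Mathlib

/-- A solution of the Fermat equation with exponent `p` in the first case:
`x ^ p + y ^ p + z ^ p = 0` with `p ∤ x y z` (so `x, y, z` are non-zero). -/
def IsFirstCaseSolution (p : ℕ) (x y z : ℤ) : Prop :=
  x ^ p + y ^ p + z ^ p = 0 ∧ ¬ (p : ℤ) ∣ x * y * z

/-- The first case of Fermat's Last Theorem holds for the exponent `p`. -/
def FirstCaseHolds (p : ℕ) : Prop :=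
  ∀ x y z : ℤ, ¬ IsFirstCaseSolution p x y z

/-- The real half-open interval `[l p / (d + 1), l p / d[`. -/
def block (p d l : ℕ) : Set ℝ :=
  Set.Ico ((l : ℝ) * p / (d + 1)) ((l : ℝ) * p / d)

open Classical in
/-- The residue class modulo `p` of the sum of `1 / j ^ μ` over the integers `j ∈ A`, for a set
`A ⊆ ]0, p[` of real numbers. It is `0` if and only if `p` divides the sum. -/
noncomputable def recipSum (p μ : ℕ) (A : Set ℝ) : ZMod p :=
  ∑ j ∈ (Finset.Icc 1 (p - 1)).filter (fun j : ℕ => (j : ℝ) ∈ A), ((j : ZMod p) ^ μ)⁻¹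

/-- The odd Mirimanoff polynomial `φ_{2m+1}(T) = 1^{2m} T + 2^{2m} T^2 + ⋯ + (p-1)^{2m} T^{p-1}`. -/
noncomputable def oddMirimanoff (p m : ℕ) : Polynomial ℤ :=
  ∑ i ∈ Finset.Icc 1 (p - 1), Polynomial.C ((i : ℤ) ^ (2 * m)) * Polynomial.X ^ i

open Classical in
/-- The set `C_M` of the `m` with `1 ≤ m ≤ (p - 3) / 2` and `φ_{2m+1}(t) ≢ 0 mod p`. -/
noncomputable def mirimanoffSupport (p : ℕ) (t : ZMod p) : Finset ℕ :=
  (Finset.Icc 1 ((p - 3) / 2)).filter (fun m => Polynomial.aeval t (oddMirimanoff p m) ≠ 0)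

/-- The `p`-rank of the class group of the `p`-th cyclotomic field: the dimension over the field
with `p` elements of the subgroup of the classes `c` with `c ^ p = 1`. -/
noncomputable def cyclotomicClassGroupRank (p : ℕ) [NeZero p] : ℕ :=
  letI : Module (ZMod p) (AddSubgroup.torsionBy
      (Additive (ClassGroup (NumberField.RingOfIntegers (CyclotomicField p ℚ)))) (p : ℤ)) :=
    AddSubgroup.torsionBy.zmodModule
  Module.finrank (ZMod p) (AddSubgroup.torsionBy
      (Additive (ClassGroup (NumberField.RingOfIntegers (CyclotomicField p ℚ)))) (p : ℤ))

/-!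
Let `K` be the `p`-th cyclotomic field, `ζ` a primitive `p`-th root of unity in it, and let
`x ^ p + y ^ p + z ^ p = 0` with `p ∤ x y z` and, without loss of generality, `x` and `y` coprime.
Put `t = -x / y` modulo `p`.

*From principal ideals to congruences.* The ideals `(x + y ζ ^ a)` are pairwise coprime with
product `(z) ^ p`, so that `(x + y ζ) = I ^ p`. Suppose that a product `∏ (σ_a I) ^ n_a` of
conjugates of `I` is principal. Then `∏ (x + y ζ ^ a) ^ n_a` is a unit times a `p`-th power.
Dividing by the complex conjugate turns the unit into some `± ζ ^ k`, and a `p`-th power is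
congruent to a rational integer modulo `p`; so the product and its conjugate agree up to `± ζ ^ k`
modulo `p`, that is, in `𝔽_p[X] / (X - 1) ^ (p - 1)`. Taking the logarithmic derivative of order
`2 m + 1` at `X = 1` gives `φ_{2m+1}(t) ∑ n_a a ^ (2 m + 1) = 0`
(`mirimanoffValue_mul_sum_eq_zero_of_isPrincipal`).

*The two sources of principal products.* First, every prime factor of `x + y ζ` has residue degree
one and lies away from `p`, so a Jacobi sum generates the product of its conjugates over half of the
Galois group (`isPrincipal_prod_map_cycloAut_ker`); for suitable characters this half is described
by the union of the blocks `[l p / (d + 1), l p / d[`. Hence the sum of `1 / j ^ (2 m + 1)` over this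
union vanishes modulo `p` as soon as `φ_{2m+1}(t) ≠ 0`
(`IsFirstCaseSolution.recipSum_eq_zero`). Secondly, a linear relation in the class group between the
classes `∑ a ^ (-2 m - 1) [σ_a I]` with `φ_{2m+1}(t) ≠ 0` is a principal product, and the
congruences above force its coefficients to vanish by orthogonality; this bounds the `p`-rank from
below (`card_mirimanoffSupport_le_finrank`).

*Non-vanishing.* For `k = 3, 5, 7, 9` the value `φ_k(t)` is an Eulerian polynomial in `t` divided by
a power of `1 - t`. Elimination shows that at most one of the four vanishes, and that for one of the
pairs taken from `x, y, z` the first three do not vanish, apart from a few primes. These primes are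
excluded by Cauchy's criterion, which is the case `d = m = 1` and needs only `φ_3(t) ≠ 0`.

Finally, the indicator function `χ` of a union of blocks satisfies `χ(-j) = 1 - χ(j)`, so the sum
for two parameters is half the sum of the two sums for one parameter.
-/

/-! ### Values of the Mirimanoff polynomials -/

/-- The value at `t` of the Mirimanoff polynomial `∑_{i < p} i ^ k T ^ i` over the field with `p`
elements; the term `i = 0` contributes only for `k = 0`. -/
noncomputable def mirimanoffValue (p k : ℕ) (t : ZMod p) : ZMod p :=
  ∑ i ∈ Finset.range p, (i : ZMod p) ^ k * t ^ i

section MirimanoffValues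

variable {p : ℕ} [Fact p.Prime]

theorem aeval_oddMirimanoff {m : ℕ} (hm : 1 ≤ m) (t : ZMod p) :
    Polynomial.aeval t (oddMirimanoff p m) = mirimanoffValue p (2 * m) t := by
  have hp := (Fact.out : p.Prime).pos
  have h : Finset.range p = insert 0 (Finset.Icc 1 (p - 1)) := by
    ext i; simp; omega
  rw [oddMirimanoff, mirimanoffValue, h, Finset.sum_insert (by simp)]
  simp [show 2 * m ≠ 0 by omega]

theorem mem_mirimanoffSupport {m : ℕ} {t : ZMod p} :
    m ∈ mirimanoffSupport p t ↔
      (1 ≤ m ∧ m ≤ (p - 3) / 2) ∧ mirimanoffValue p (2 * m) t ≠ 0 := by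
  simp only [mirimanoffSupport, Finset.mem_filter, Finset.mem_Icc]
  refine and_congr_right fun h => ?_
  rw [aeval_oddMirimanoff h.1]

theorem mirimanoffValue_zero {t : ZMod p} (ht : t ≠ 1) : mirimanoffValue p 0 t = 1 := by
  have h := mul_geom_sum t p
  rw [ZMod.pow_card] at h
  have h1 : t - 1 ≠ 0 := sub_ne_zero.2 ht
  simpa [mirimanoffValue, h1] using h

/-- The recurrence comes from the invariance of the sum under the shift `i ↦ i + 1`: the boundary
terms vanish because `p = 0` in the field. -/
theorem mirimanoffValue_rec {k : ℕ} (hk : k ≠ 0) (t : ZMod p) :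
    (1 - t) * mirimanoffValue p k t =
      t * ∑ j ∈ Finset.range k, (k.choose j : ZMod p) * mirimanoffValue p j t := by
  have h1 : ∑ i ∈ Finset.range p, ((i + 1 : ℕ) : ZMod p) ^ k * t ^ (i + 1) =
      mirimanoffValue p k t := by
    have := (Finset.sum_range_succ' (fun i : ℕ => (i : ZMod p) ^ k * t ^ i) p).symm.trans
      (Finset.sum_range_succ _ p)
    simpa [hk, mirimanoffValue] using this
  have h2 : ∑ i ∈ Finset.range p, ((i + 1 : ℕ) : ZMod p) ^ k * t ^ (i + 1) =
      t * ∑ j ∈ Finset.range (k + 1), (k.choose j : ZMod p) * mirimanoffValue p j t := by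
    simp_rw [mirimanoffValue, Finset.mul_sum]
    rw [Finset.sum_comm]
    refine Finset.sum_congr rfl fun i _ => ?_
    push_cast
    rw [add_pow, Finset.sum_mul]
    refine Finset.sum_congr rfl fun j _ => ?_
    simp only [one_pow]; ring
  rw [Finset.sum_range_succ, Nat.choose_self] at h2
  linear_combination h2 - h1

/-- The closed forms of the even Mirimanoff values; the numerators are the Eulerian polynomials. -/
theorem mirimanoffValue_closed {t : ZMod p} (ht : t ≠ 1) :
    (1 - t) ^ 2 * mirimanoffValue p 2 t = t * (1 + t) ∧
    (1 - t) ^ 4 * mirimanoffValue p 4 t = t * (1 + t) * (t ^ 2 + 10 * t + 1) ∧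
    (1 - t) ^ 6 * mirimanoffValue p 6 t =
      t * (1 + t) * (t ^ 4 + 56 * t ^ 3 + 246 * t ^ 2 + 56 * t + 1) ∧
    (1 - t) ^ 8 * mirimanoffValue p 8 t = t * (1 + t) * (t ^ 6 + 246 * t ^ 5 + 4047 * t ^ 4
      + 11572 * t ^ 3 + 4047 * t ^ 2 + 246 * t + 1) := by
  have e0 := mirimanoffValue_zero ht
  have r1 := mirimanoffValue_rec one_ne_zero t
  have r2 := mirimanoffValue_rec two_ne_zero t
  have r3 := mirimanoffValue_rec three_ne_zero t
  have r4 := mirimanoffValue_rec four_ne_zero t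
  have r5 := mirimanoffValue_rec (show 5 ≠ 0 by norm_num) t
  have r6 := mirimanoffValue_rec (show 6 ≠ 0 by norm_num) t
  have r7 := mirimanoffValue_rec (show 7 ≠ 0 by norm_num) t
  have r8 := mirimanoffValue_rec (show 8 ≠ 0 by norm_num) t
  simp only [Finset.sum_range_succ, Finset.sum_range_zero, Nat.choose, zero_add, add_zero,
    Nat.reduceAdd, Nat.cast_ofNat, Nat.cast_one, e0] at r2 r3 r4 r5 r6 r7 r8
  have e1 : (1 - t) * mirimanoffValue p 1 t = t := by simpa [e0] using r1
  have e2 : (1 - t) ^ 2 * mirimanoffValue p 2 t = t * (1 + t) := by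
    linear_combination (1 - t) * r2 + 2 * t * e1
  have e3 : (1 - t) ^ 3 * mirimanoffValue p 3 t = t * (1 + 4 * t + t ^ 2) := by
    linear_combination (1 - t) ^ 2 * r3 + 3 * t * (1 - t) * e1 + 3 * t * e2
  have e4 : (1 - t) ^ 4 * mirimanoffValue p 4 t = t * (1 + 11 * t + 11 * t ^ 2 + t ^ 3) := by
    linear_combination (1 - t) ^ 3 * r4 + 4 * t * (1 - t) ^ 2 * e1 + 6 * t * (1 - t) * e2 +
      4 * t * e3
  have e5 : (1 - t) ^ 5 * mirimanoffValue p 5 t =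
      t * (1 + 26 * t + 66 * t ^ 2 + 26 * t ^ 3 + t ^ 4) := by
    linear_combination (1 - t) ^ 4 * r5 + 5 * t * (1 - t) ^ 3 * e1 + 10 * t * (1 - t) ^ 2 * e2 +
      10 * t * (1 - t) * e3 + 5 * t * e4
  have e6 : (1 - t) ^ 6 * mirimanoffValue p 6 t =
      t * (1 + 57 * t + 302 * t ^ 2 + 302 * t ^ 3 + 57 * t ^ 4 + t ^ 5) := by
    linear_combination (1 - t) ^ 5 * r6 + 6 * t * (1 - t) ^ 4 * e1 + 15 * t * (1 - t) ^ 3 * e2 +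
      20 * t * (1 - t) ^ 2 * e3 + 15 * t * (1 - t) * e4 + 6 * t * e5
  have e7 : (1 - t) ^ 7 * mirimanoffValue p 7 t =
      t * (1 + 120 * t + 1191 * t ^ 2 + 2416 * t ^ 3 + 1191 * t ^ 4 + 120 * t ^ 5 + t ^ 6) := by
    linear_combination (1 - t) ^ 6 * r7 + 7 * t * (1 - t) ^ 5 * e1 + 21 * t * (1 - t) ^ 4 * e2 +
      35 * t * (1 - t) ^ 3 * e3 + 35 * t * (1 - t) ^ 2 * e4 + 21 * t * (1 - t) * e5 + 7 * t * e6
  refine ⟨e2, by linear_combination e4, by linear_combination e6, ?_⟩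
  linear_combination (1 - t) ^ 7 * r8 + 8 * t * (1 - t) ^ 6 * e1 + 28 * t * (1 - t) ^ 5 * e2 +
    56 * t * (1 - t) ^ 4 * e3 + 70 * t * (1 - t) ^ 3 * e4 + 56 * t * (1 - t) ^ 2 * e5 +
    28 * t * (1 - t) * e6 + 8 * t * e7

theorem one_mem_mirimanoffSupport {t : ZMod p} (hp : 5 < p) (h0 : t ≠ 0) (h1 : t ≠ 1)
    (h2 : t ≠ -1) : 1 ∈ mirimanoffSupport p t := by
  refine mem_mirimanoffSupport.2 ⟨⟨le_rfl, by omega⟩, fun h => ?_⟩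
  have h3 : 1 + t ≠ 0 := fun h => h2 (by linear_combination h)
  have := (mirimanoffValue_closed h1).1
  simp_all

theorem two_mem_mirimanoffSupport {t : ZMod p} (hp : 6 < p) (h0 : t ≠ 0) (h1 : t ≠ 1)
    (h2 : t ≠ -1) (h : t ^ 2 + 10 * t + 1 ≠ 0) : 2 ∈ mirimanoffSupport p t := by
  refine mem_mirimanoffSupport.2 ⟨⟨by norm_num, by omega⟩, fun h => ?_⟩
  have h3 : 1 + t ≠ 0 := fun h => h2 (by linear_combination h)
  have := (mirimanoffValue_closed h1).2.1
  simp_all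

theorem three_mem_mirimanoffSupport {t : ZMod p} (hp : 8 < p) (h0 : t ≠ 0) (h1 : t ≠ 1)
    (h2 : t ≠ -1) (h : t ^ 4 + 56 * t ^ 3 + 246 * t ^ 2 + 56 * t + 1 ≠ 0) :
    3 ∈ mirimanoffSupport p t := by
  refine mem_mirimanoffSupport.2 ⟨⟨by norm_num, by omega⟩, fun h => ?_⟩
  have h3 : 1 + t ≠ 0 := fun h => h2 (by linear_combination h)
  have := (mirimanoffValue_closed h1).2.2.1
  simp_all

theorem four_mem_mirimanoffSupport {t : ZMod p} (hp : 10 < p) (h0 : t ≠ 0) (h1 : t ≠ 1)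
    (h2 : t ≠ -1) (h : t ^ 6 + 246 * t ^ 5 + 4047 * t ^ 4
      + 11572 * t ^ 3 + 4047 * t ^ 2 + 246 * t + 1 ≠ 0) : 4 ∈ mirimanoffSupport p t := by
  refine mem_mirimanoffSupport.2 ⟨⟨by norm_num, by omega⟩, fun h => ?_⟩
  have h3 : 1 + t ≠ 0 := fun h => h2 (by linear_combination h)
  have := (mirimanoffValue_closed h1).2.2.2
  simp_all

theorem natCast_zmod_ne_zero_of_coprime {n : ℕ} (h : n.Coprime p) : (n : ZMod p) ≠ 0 := by
  rw [Ne, ZMod.natCast_eq_zero_iff]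
  intro hd
  exact (Fact.out : p.Prime).one_lt.ne' (Nat.dvd_one.1 (h ▸ Nat.dvd_gcd hd dvd_rfl))

/-- Among the four values `φ₃(t), φ₅(t), φ₇(t), φ₉(t)` at most one vanishes unless `p = 823`. -/
theorem three_le_card_mirimanoffSupport {t : ZMod p} (hp : 10 < p) (hp' : p ≠ 823) (h0 : t ≠ 0)
    (h1 : t ≠ 1) (h2 : t ≠ -1) : 3 ≤ (mirimanoffSupport p t).card := by
  have hP : p.Prime := Fact.out
  have c2 : p.Coprime 2 := (Nat.coprime_primes hP Nat.prime_two).2 (by omega)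
  have c3 : p.Coprime 3 := (Nat.coprime_primes hP Nat.prime_three).2 (by omega)
  have c5 : p.Coprime 5 := (Nat.coprime_primes hP Nat.prime_five).2 (by omega)
  have c823 : p.Coprime 823 := (Nat.coprime_primes hP (by norm_num)).2 hp'
  have m1 := one_mem_mirimanoffSupport (by omega) h0 h1 h2
  have key : ∀ {a b : ℕ}, a ∈ mirimanoffSupport p t → b ∈ mirimanoffSupport p t → a ≠ 1 → b ≠ 1 →
      a ≠ b → 3 ≤ (mirimanoffSupport p t).card := by
    intro a b ha hb ha1 hb1 hab
    have : ({1, a, b} : Finset ℕ) ⊆ mirimanoffSupport p t := by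
      simp [Finset.insert_subset_iff, m1, ha, hb]
    refine le_trans ?_ (Finset.card_le_card this)
    rw [Finset.card_eq_three.2 ⟨1, a, b, ha1.symm, hb1.symm, hab, rfl⟩]
  have n216 : ((2 ^ 3 * 3 ^ 3 : ℕ) : ZMod p) ≠ 0 :=
    natCast_zmod_ne_zero_of_coprime ((c2.pow_right 3).mul_right (c3.pow_right 3)).symm
  have n5760 : ((2 ^ 7 * 3 ^ 2 * 5 : ℕ) : ZMod p) ≠ 0 :=
    natCast_zmod_ne_zero_of_coprime
      (((c2.pow_right 7).mul_right (c3.pow_right 2)).mul_right c5).symm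
  have n360 : ((2 ^ 3 * 3 ^ 2 * 5 : ℕ) : ZMod p) ≠ 0 :=
    natCast_zmod_ne_zero_of_coprime
      (((c2.pow_right 3).mul_right (c3.pow_right 2)).mul_right c5).symm
  have n6584 : ((2 ^ 3 * 823 : ℕ) : ZMod p) ≠ 0 :=
    natCast_zmod_ne_zero_of_coprime ((c2.pow_right 3).mul_right c823).symm
  push_cast at n216 n5760 n360 n6584
  -- With `s = t + 1 / t` the three factors are `s + 10`, `s ^ 2 + 56 s + 244` and
  -- `s ^ 3 + 246 s ^ 2 + 4044 s + 11080`, and the identities below are divisions with remainder.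
  by_cases q2 : t ^ 2 + 10 * t + 1 = 0
  · refine key (three_mem_mirimanoffSupport (by omega) h0 h1 h2 fun h => ?_)
      (four_mem_mirimanoffSupport hp h0 h1 h2 fun h => ?_) (by norm_num) (by norm_num) (by norm_num)
    · refine mul_ne_zero n216 (pow_ne_zero 2 h0) ?_
      linear_combination (t ^ 2 + 46 * t + 1) * q2 - h
    · refine mul_ne_zero n5760 (pow_ne_zero 3 h0) ?_
      linear_combination (t ^ 4 + 236 * t ^ 3 + 1686 * t ^ 2 + 236 * t + 1) * q2 - h
  · have m2 := two_mem_mirimanoffSupport (by omega) h0 h1 h2 q2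
    by_cases q3 : t ^ 4 + 56 * t ^ 3 + 246 * t ^ 2 + 56 * t + 1 = 0
    · refine key m2 (four_mem_mirimanoffSupport hp h0 h1 h2 fun h => ?_) (by norm_num)
        (by norm_num) (by norm_num)
      have r : 19 * t ^ 2 + 98 * t + 19 = 0 := by
        have : 360 * t ^ 2 * (19 * t ^ 2 + 98 * t + 19) = 0 := by
          linear_combination (t ^ 2 + 190 * t + 1) * q3 - h
        exact (mul_eq_zero.1 this).resolve_left (mul_ne_zero n360 (pow_ne_zero 2 h0))
      refine mul_ne_zero n6584 (pow_ne_zero 2 h0) ?_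
      linear_combination (19 * t ^ 2 + 966 * t + 19) * r - 361 * q3
    · exact key m2 (three_mem_mirimanoffSupport (by omega) h0 h1 h2 q3) (by norm_num)
        (by norm_num) (by norm_num)

/-- The elimination behind the choice of a pair among `x, y, z`: for `x + y + z = 0` the
quantities `x ^ 2 / (y z), y ^ 2 / (z x), z ^ 2 / (x y)` have sum `3` and product `1`, and they
cannot all be `4`, `12` or a root of `w ^ 2 - 60 w + 360`. -/
theorem exists_avoid_of_sum_eq_three_of_prod_eq_one (hp : 7 < p)
    (hp' : p ∉ ({11, 23, 43, 113, 223, 1609} : Finset ℕ)) {w : Fin 3 → ZMod p}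
    (hs : w 0 + w 1 + w 2 = 3) (hm : w 0 * w 1 * w 2 = 1) :
    ∃ i, w i ≠ 4 ∧ w i ≠ 12 ∧ w i ^ 2 - 60 * w i + 360 ≠ 0 := by
  have hP : p.Prime := Fact.out
  have cop : ∀ {q : ℕ}, q.Prime → p ≠ q → p.Coprime q := fun hq h =>
    (Nat.coprime_primes hP hq).2 h
  simp only [Finset.mem_insert, Finset.mem_singleton, not_or] at hp'
  obtain ⟨p11, p23, p43, p113, p223, p1609⟩ := hp'
  have c2 := cop Nat.prime_two (by omega)
  have c3 := cop Nat.prime_three (by omega)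
  have c5 := cop Nat.prime_five (by omega)
  have c7 := cop (show Nat.Prime 7 by norm_num) (by omega)
  have c11 := cop (show Nat.Prime 11 by norm_num) p11
  have c43 := cop (show Nat.Prime 43 by norm_num) p43
  have c113 := cop (show Nat.Prime 113 by norm_num) p113
  have c223 := cop (show Nat.Prime 223 by norm_num) p223
  have c1609 := cop (show Nat.Prime 1609 by norm_num) p1609
  have n9 : ((3 ^ 2 : ℕ) : ZMod p) ≠ 0 := natCast_zmod_ne_zero_of_coprime (c3.pow_right 2).symm
  have n25 : ((5 ^ 2 : ℕ) : ZMod p) ≠ 0 := natCast_zmod_ne_zero_of_coprime (c5.pow_right 2).symm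
  have n1561 : ((7 * 223 : ℕ) : ZMod p) ≠ 0 :=
    natCast_zmod_ne_zero_of_coprime (c7.mul_right c223).symm
  have n3025 : ((5 ^ 2 * 11 ^ 2 : ℕ) : ZMod p) ≠ 0 :=
    natCast_zmod_ne_zero_of_coprime ((c5.pow_right 2).mul_right (c11.pow_right 2)).symm
  have n16090 : ((2 * 5 * 1609 : ℕ) : ZMod p) ≠ 0 :=
    natCast_zmod_ne_zero_of_coprime ((c2.mul_right c5).mul_right c1609).symm
  have n34013 : ((3 * (7 * 43 * 113) : ℕ) : ZMod p) ≠ 0 :=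
    natCast_zmod_ne_zero_of_coprime
      (c3.mul_right ((c7.mul_right c43).mul_right c113)).symm
  push_cast at n9 n25 n1561 n3025 n16090 n34013
  let B (u : ZMod p) : Prop := u = 4 ∨ u = 12 ∨ u ^ 2 - 60 * u + 360 = 0
  -- If one value is `4`, the two others are both equal to `-1 / 2`.
  have four : ∀ a b c : ZMod p, a + b + c = 3 → a * b * c = 1 → a = 4 → ¬ B b := by
    rintro a b c h1 h2 rfl
    have hb : 2 * b + 1 = 0 := by
      have : (2 * b + 1) ^ 2 = 0 := by linear_combination 4 * b * h1 - h2
      exact pow_eq_zero_iff two_ne_zero |>.1 this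
    rintro (rfl | rfl | h)
    · exact n9 (by linear_combination hb)
    · exact n25 (by linear_combination hb)
    · exact n1561 (by linear_combination 4 * h - (2 * b - 121) * hb)
  have twelve : ∀ a b c : ZMod p, a + b + c = 3 → a * b * c = 1 → a = 12 → B b → ¬ B c := by
    rintro a b c h1 h2 rfl hb hc
    have eb : 12 * b ^ 2 + 108 * b + 1 = 0 := by linear_combination 12 * b * h1 - h2
    have ec : 12 * c ^ 2 + 108 * c + 1 = 0 := by linear_combination 12 * c * h1 - h2
    rcases hb with hb | rfl | hb
    · exact four b c 12 (by linear_combination h1) (by linear_combination h2) hb hc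
    · exact n3025 (by linear_combination eb)
    rcases hc with hc | rfl | hc
    · exact four c 12 b (by linear_combination h1) (by linear_combination h2) hc (Or.inr (Or.inl rfl))
    · exact n3025 (by linear_combination ec)
    exact n16090 (by linear_combination 828 * h1 - (eb - 12 * hb) - (ec - 12 * hc))
  have roots : ∀ a b c : ZMod p, a + b + c = 3 → a * b * c = 1 → a ^ 2 - 60 * a + 360 = 0 →
      b ^ 2 - 60 * b + 360 = 0 → c ^ 2 - 60 * c + 360 = 0 → False := by
    intro a b c h1 h2 ha hb hc
    have e2 : 2 * (a * b + b * c + c * a) = 909 := by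
      linear_combination (a + b + c + 3) * h1 - ha - hb - hc - 60 * h1
    have cub : ∀ u : ZMod p, (u - a) * (u - b) * (u - c) = 0 → u ^ 2 - 60 * u + 360 = 0 →
        7029 * u = 41042 := by
      intro u hu hu'
      have : 2 * u ^ 3 - 6 * u ^ 2 + 909 * u - 2 = 0 := by
        linear_combination 2 * hu + 2 * u ^ 2 * h1 - u * e2 + 2 * h2
      linear_combination this - (2 * u + 114) * hu'
    have ua := cub a (by ring) ha
    have ub := cub b (by ring) hb
    have uc := cub c (by ring) hc
    exact n34013 (by linear_combination 7029 * h1 - ua - ub - uc)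
  by_contra! hcon
  have bad : ∀ i, B (w i) := by
    intro i
    by_cases h4 : w i = 4
    · exact Or.inl h4
    by_cases h12 : w i = 12
    · exact Or.inr (Or.inl h12)
    · exact Or.inr (Or.inr (hcon i h4 h12))
  have s1 : w 1 + w 2 + w 0 = 3 := by linear_combination hs
  have m1 : w 1 * w 2 * w 0 = 1 := by linear_combination hm
  have s2 : w 2 + w 0 + w 1 = 3 := by linear_combination hs
  have m2 : w 2 * w 0 * w 1 = 1 := by linear_combination hm
  rcases bad 0 with h | h | h0
  · exact four _ _ _ hs hm h (bad 1)
  · exact twelve _ _ _ hs hm h (bad 1) (bad 2)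
  rcases bad 1 with h | h | h1
  · exact four _ _ _ s1 m1 h (bad 2)
  · exact twelve _ _ _ s1 m1 h (bad 2) (bad 0)
  rcases bad 2 with h | h | h2
  · exact four _ _ _ s2 m2 h (bad 0)
  · exact twelve _ _ _ s2 m2 h (bad 0) (bad 1)
  exact roots _ _ _ hs hm h0 h1 h2

/-- The sum of Cauchy's criterion does not vanish modulo the primes left out by the elimination. -/
theorem sum_inv_cube_ne_zero
    (hp : p ∈ ({7, 11, 23, 43, 113, 223, 823, 1609} : Finset ℕ)) :
    ∑ j ∈ Finset.Icc 1 ((p - 1) / 2), ((j : ZMod p) ^ 3)⁻¹ ≠ 0 := by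
  have h7 : 7 ≤ p := by
    simp only [Finset.mem_insert, Finset.mem_singleton] at hp; omega
  have key : ∑ j ∈ Finset.Icc 1 ((p - 1) / 2), ((j : ZMod p) ^ 3)⁻¹ =
      ((∑ j ∈ Finset.Icc 1 ((p - 1) / 2), j ^ (p - 4) % p : ℕ) : ZMod p) := by
    rw [Nat.cast_sum]
    refine Finset.sum_congr rfl fun j hj => ?_
    rw [Finset.mem_Icc] at hj
    have hj0 : (j : ZMod p) ≠ 0 := by
      rw [Ne, ZMod.natCast_eq_zero_iff]
      exact Nat.not_dvd_of_pos_of_lt (by omega) (by omega)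
    rw [ZMod.natCast_mod, Nat.cast_pow, inv_eq_iff_eq_inv, ← mul_eq_one_iff_eq_inv₀
      (pow_ne_zero _ hj0), ← pow_add, show 3 + (p - 4) = p - 1 by omega,
      ZMod.pow_card_sub_one_eq_one hj0]
  rw [key, Ne, ZMod.natCast_eq_zero_iff, Nat.dvd_iff_mod_eq_zero]
  simp only [Finset.mem_insert, Finset.mem_singleton] at hp
  rcases hp with rfl | rfl | rfl | rfl | rfl | rfl | rfl | rfl <;> decide +kernel

end MirimanoffValues

/-! ### Logarithmic derivatives modulo `(X - 1) ^ (p - 1)` -/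

section LogarithmicDerivative

open Polynomial

variable {p : ℕ} [Fact p.Prime]

/-- The Euler operator `X d/dX`. -/
noncomputable def eulerOp (f : (ZMod p)[X]) : (ZMod p)[X] := X * derivative f

theorem eulerOp_sub (f g : (ZMod p)[X]) : eulerOp (f - g) = eulerOp f - eulerOp g := by
  simp [eulerOp, mul_sub]

theorem eulerOp_mul (f g : (ZMod p)[X]) : eulerOp (f * g) = eulerOp f * g + f * eulerOp g := by
  simp only [eulerOp, derivative_mul]; ring

theorem pow_dvd_eulerOp {n : ℕ} {f : (ZMod p)[X]} (h : (X - 1) ^ (n + 1) ∣ f) :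
    (X - 1) ^ n ∣ eulerOp f := by
  obtain ⟨g, rfl⟩ := h
  rw [eulerOp_mul]
  refine dvd_add (Dvd.dvd.mul_right ?_ _) (Dvd.dvd.mul_right (pow_dvd_pow _ n.le_succ) _)
  simp only [eulerOp, derivative_pow, Nat.add_sub_cancel]
  exact (((dvd_refl _).mul_left _).mul_right _).mul_left _

/-- The linear functional `f ↦ ((X d/dX) ^ k f)(1)`, given on monomials by `X ^ n ↦ n ^ k`. -/
noncomputable def powerMoment (k : ℕ) (f : (ZMod p)[X]) : ZMod p :=
  eval 1 (eulerOp^[k] f)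

theorem powerMoment_eq_zero {k : ℕ} {f : (ZMod p)[X]} (h : (X - 1) ^ (k + 1) ∣ f) :
    powerMoment k f = 0 := by
  induction k generalizing f with
  | zero => obtain ⟨g, rfl⟩ := h; simp [powerMoment]
  | succ k ih =>
    rw [powerMoment, Function.iterate_succ_apply]
    exact ih (pow_dvd_eulerOp h)

theorem powerMoment_monomial (k n : ℕ) (c : ZMod p) :
    powerMoment k (monomial n c) = c * (n : ZMod p) ^ k := by
  have : eulerOp^[k] (monomial n c) = monomial n (c * (n : ZMod p) ^ k) := by
    induction k with
    | zero => simp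
    | succ k ih =>
      rw [Function.iterate_succ_apply', ih, eulerOp, derivative_monomial]
      rcases n with _ | n
      · simp
      · rw [Nat.add_sub_cancel, X_mul_monomial, pow_succ, mul_assoc]
  simp [powerMoment, this]

theorem powerMoment_add (k : ℕ) (f g : (ZMod p)[X]) :
    powerMoment k (f + g) = powerMoment k f + powerMoment k g := by
  have : eulerOp^[k] (f + g) = eulerOp^[k] f + eulerOp^[k] g := by
    induction k with
    | zero => rfl
    | succ k ih =>
      rw [Function.iterate_succ_apply', ih, Function.iterate_succ_apply',
        Function.iterate_succ_apply']
      simp [eulerOp, mul_add]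
  simp [powerMoment, this]

theorem powerMoment_C_mul (k : ℕ) (c : ZMod p) (f : (ZMod p)[X]) :
    powerMoment k (C c * f) = c * powerMoment k f := by
  have : eulerOp^[k] (C c * f) = C c * eulerOp^[k] f := by
    induction k with
    | zero => rfl
    | succ k ih =>
      rw [Function.iterate_succ_apply', ih, Function.iterate_succ_apply']
      simp [eulerOp, mul_left_comm]
  simp [powerMoment, this]

theorem powerMoment_sum {ι : Type*} (k : ℕ) (s : Finset ι) (f : ι → (ZMod p)[X]) :
    powerMoment k (∑ i ∈ s, f i) = ∑ i ∈ s, powerMoment k (f i) := by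
  classical
  induction s using Finset.induction_on with
  | empty => simpa using powerMoment_C_mul k 0 (0 : (ZMod p)[X])
  | insert i s hi ih => rw [Finset.sum_insert hi, Finset.sum_insert hi, powerMoment_add, ih]

/-- `L / (1 - t)` represents the logarithmic derivative of `F` modulo `(X - 1) ^ p`. The factor
`1 - t` makes a polynomial representative available for the factors `X ^ j - t`. -/
def IsLogDeriv (t : ZMod p) (F L : (ZMod p)[X]) : Prop :=
  (X - 1) ^ p ∣ C (1 - t) * eulerOp F - F * L

theorem IsLogDeriv.mul {t : ZMod p} {F G L M : (ZMod p)[X]} (h1 : IsLogDeriv t F L)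
    (h2 : IsLogDeriv t G M) : IsLogDeriv t (F * G) (L + M) := by
  have := dvd_add (h1.mul_right G) (h2.mul_left F)
  rw [IsLogDeriv, eulerOp_mul]
  convert this using 1
  ring

theorem isLogDeriv_C (t c : ZMod p) : IsLogDeriv t (C c) 0 := by
  simp [IsLogDeriv, eulerOp]

theorem isLogDeriv_X_pow (t : ZMod p) (k : ℕ) : IsLogDeriv t (X ^ k) (C ((1 - t) * k)) := by
  have : eulerOp ((X : (ZMod p)[X]) ^ k) = C (k : ZMod p) * X ^ k := by
    rcases k with _ | k
    · simp [eulerOp]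
    · simp only [eulerOp, derivative_X_pow, Nat.add_sub_cancel]; ring
  rw [IsLogDeriv, this, C_mul]
  convert dvd_zero _ using 1
  ring

theorem IsLogDeriv.pow {t : ZMod p} {F L : (ZMod p)[X]} (h : IsLogDeriv t F L) (n : ℕ) :
    IsLogDeriv t (F ^ n) (C (n : ZMod p) * L) := by
  induction n with
  | zero => simpa using isLogDeriv_C t 1
  | succ n ih =>
    have := ih.mul h
    rw [← pow_succ] at this
    rwa [Nat.cast_succ, C_add, C_1, add_mul, one_mul]

theorem IsLogDeriv.prod {ι : Type*} {t : ZMod p} {s : Finset ι} {F L : ι → (ZMod p)[X]}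
    (h : ∀ i ∈ s, IsLogDeriv t (F i) (L i)) : IsLogDeriv t (∏ i ∈ s, F i) (∑ i ∈ s, L i) := by
  classical
  induction s using Finset.induction_on with
  | empty => simpa using isLogDeriv_C t 1
  | insert i s hi ih =>
    rw [Finset.prod_insert hi, Finset.sum_insert hi]
    exact (h i (by simp)).mul (ih fun j hj => h j (by simp [hj]))

/-- The representative `∑ X ^ (j i) t ^ (p - i)`, up to the factor `j`, of the logarithmic
derivative of `X ^ j - t`. -/
noncomputable def geomRep (t : ZMod p) (j : ℕ) : (ZMod p)[X] :=
  ∑ i ∈ Finset.range p, monomial (j * (i + 1)) (t ^ (p - 1 - i))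

theorem X_sub_one_pow_char : ((X : (ZMod p)[X]) - 1) ^ p = X ^ p - 1 := by
  rw [sub_pow_char, one_pow]

theorem isLogDeriv_X_pow_sub_C (t : ZMod p) (j : ℕ) :
    IsLogDeriv t (X ^ j - C t) (C (j : ZMod p) * geomRep t j) := by
  have h1 : eulerOp ((X : (ZMod p)[X]) ^ j - C t) = C (j : ZMod p) * X ^ j := by
    rcases j with _ | j
    · simp [eulerOp]
    · simp only [eulerOp, derivative_sub, derivative_X_pow, derivative_C, Nat.add_sub_cancel]; ring
  have h2 : (X ^ j - C t) * geomRep t j = X ^ j * ((X ^ p) ^ j - C t) := by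
    have hg := (Commute.all ((X : (ZMod p)[X]) ^ j) (C t)).mul_geom_sum₂ p
    have ht : C t ^ p = C t := by rw [← C_pow, ZMod.pow_card]
    rw [ht, ← pow_mul, mul_comm j p, pow_mul] at hg
    rw [← hg, mul_left_comm, geomRep]
    congr 1
    rw [Finset.mul_sum]
    refine Finset.sum_congr rfl fun i _ => ?_
    rw [← C_mul_X_pow_eq_monomial, C_pow]
    ring
  rw [IsLogDeriv, h1, X_sub_one_pow_char]
  have h3 : (X : (ZMod p)[X]) ^ p - 1 ∣ 1 - (X ^ p) ^ j := by
    rw [← neg_sub ((X ^ p) ^ j), dvd_neg]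
    simpa using sub_dvd_pow_sub_pow ((X : (ZMod p)[X]) ^ p) 1 j
  convert h3.mul_left (C (j : ZMod p) * X ^ j) using 1
  rw [mul_left_comm (X ^ j - C t), h2, C_sub, C_1]
  ring

theorem powerMoment_geomRep (m : ℕ) (t : ZMod p) (j : ℕ) :
    powerMoment (2 * m) (geomRep t j) = (j : ZMod p) ^ (2 * m) * mirimanoffValue p (2 * m) t := by
  rw [geomRep, powerMoment_sum, ← Finset.sum_range_reflect, mirimanoffValue, Finset.mul_sum]
  refine Finset.sum_congr rfl fun i hi => ?_
  rw [Finset.mem_range] at hi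
  have h1 : p - 1 - (p - 1 - i) = i := by omega
  have h2 : ((p - 1 - i + 1 : ℕ) : ZMod p) = -i := by
    rw [show p - 1 - i + 1 = p - i by omega, Nat.cast_sub hi.le]; simp
  rw [powerMoment_monomial, h1, Nat.cast_mul, h2, mul_pow, Even.neg_pow (by simp)]
  ring

theorem isLogDeriv_prod {ι : Type*} [Fintype ι] (t : ZMod p) (n f : ι → ℕ) :
    IsLogDeriv t (∏ a, (X ^ f a - C t) ^ n a)
      (∑ a, C (n a : ZMod p) * (C (f a : ZMod p) * geomRep t (f a))) :=
  IsLogDeriv.prod fun a _ => (isLogDeriv_X_pow_sub_C t (f a)).pow (n a)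

theorem IsLogDeriv.powerMoment_eq {t : ZMod p} {F H L M : (ZMod p)[X]} (hF : IsLogDeriv t F L)
    (hH : IsLogDeriv t H M) (hF1 : eval 1 F ≠ 0) (h : (X - 1) ^ (p - 1) ∣ F - H) {k : ℕ}
    (hk : k + 3 ≤ p) : powerMoment k L = powerMoment k M := by
  have d1 : (X - 1) ^ (p - 2) ∣ C (1 - t) * (eulerOp F - eulerOp H) := by
    rw [← eulerOp_sub]
    refine (pow_dvd_eulerOp ?_).mul_left _
    rwa [show p - 2 + 1 = p - 1 by omega]
  have d2 : (X - 1) ^ (p - 2) ∣ F * (L - M) := by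
    have e1 := (pow_dvd_pow (X - 1 : (ZMod p)[X]) (show p - 2 ≤ p by omega)).trans hF
    have e2 := (pow_dvd_pow (X - 1 : (ZMod p)[X]) (show p - 2 ≤ p by omega)).trans hH
    have e3 := (pow_dvd_pow (X - 1 : (ZMod p)[X]) (show p - 2 ≤ p - 1 by omega)).trans h
    have := dvd_sub (dvd_sub (dvd_add d1 e2) e1) (e3.mul_right M)
    convert this using 1
    ring
  have cop : IsCoprime ((X - 1 : (ZMod p)[X]) ^ (p - 2)) F := by
    refine IsCoprime.pow_left ?_
    have hX : (X - 1 : (ZMod p)[X]) = X - C 1 := by simp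
    rw [hX, (irreducible_X_sub_C (1 : ZMod p)).coprime_iff_not_dvd, dvd_iff_isRoot]
    exact hF1
  have d3 := cop.dvd_of_dvd_mul_left d2
  have z := powerMoment_eq_zero (k := k) ((pow_dvd_pow _ (by omega)).trans d3)
  have hsum : L = (L - M) + M := by ring
  rw [hsum, powerMoment_add, z, zero_add]

theorem powerMoment_sum_geomRep {ι : Type*} [Fintype ι] (m : ℕ) (t : ZMod p) (n f : ι → ℕ) :
    powerMoment (2 * m) (∑ a, C (n a : ZMod p) * (C (f a : ZMod p) * geomRep t (f a))) =
      mirimanoffValue p (2 * m) t * ∑ a, (n a : ZMod p) * (f a : ZMod p) ^ (2 * m + 1) := by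
  rw [powerMoment_sum, Finset.mul_sum]
  refine Finset.sum_congr rfl fun a _ => ?_
  rw [powerMoment_C_mul, powerMoment_C_mul, powerMoment_geomRep]
  ring

/-- Logarithmic differentiation of a multiplicative congruence modulo `(X - 1) ^ (p - 1)` between a
product of the `X ^ a - t` and its conjugate: the odd logarithmic derivatives of order between `3`
and `p - 2` vanish at `X = 1`. -/
theorem mirimanoffValue_mul_sum_eq_zero (hp : 2 < p) {t : ZMod p} (ht : t ≠ 1)
    (n : (ZMod p)ˣ → ℕ) (k : ℕ) (c : ZMod p)
    (h : (X - 1) ^ (p - 1) ∣ ∏ a : (ZMod p)ˣ, (X ^ (a : ZMod p).val - C t) ^ n a -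
      C c * X ^ k * ∏ a : (ZMod p)ˣ, (X ^ ((-a : (ZMod p)ˣ) : ZMod p).val - C t) ^ n a)
    {m : ℕ} (hm : 1 ≤ m) (hm' : m ≤ (p - 3) / 2) :
    mirimanoffValue p (2 * m) t * ∑ a : (ZMod p)ˣ, (n a : ZMod p) * (a : ZMod p) ^ (2 * m + 1) =
      0 := by
  have lF := isLogDeriv_prod t n fun a : (ZMod p)ˣ => (a : ZMod p).val
  have lH := ((isLogDeriv_C t c).mul (isLogDeriv_X_pow t k)).mul
    (isLogDeriv_prod t n fun a => ((-a : (ZMod p)ˣ) : ZMod p).val)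
  have hF1 : eval 1 (∏ a : (ZMod p)ˣ, ((X : (ZMod p)[X]) ^ (a : ZMod p).val - C t) ^ n a) ≠ 0 := by
    rw [eval_prod]
    refine Finset.prod_ne_zero_iff.2 fun a _ => ?_
    simpa using pow_ne_zero _ (sub_ne_zero.2 ht.symm)
  have key := lF.powerMoment_eq lH hF1 h (k := 2 * m) (by omega)
  have hconst : powerMoment (2 * m) (C ((1 - t) * (k : ZMod p))) = 0 := by
    rw [← monomial_zero_left, powerMoment_monomial]
    simp [show m ≠ 0 by omega]
  rw [zero_add, powerMoment_add, hconst, zero_add, powerMoment_sum_geomRep,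
    powerMoment_sum_geomRep] at key
  simp only [ZMod.natCast_zmod_val, Units.val_neg, Odd.neg_pow ⟨m, rfl⟩, mul_neg,
    Finset.sum_neg_distrib] at key
  have h2 : (2 : ZMod p) ≠ 0 := by
    have := natCast_zmod_ne_zero_of_coprime (p := p) (n := 2)
      ((Nat.coprime_primes Nat.prime_two Fact.out).2 (by omega))
    exact_mod_cast this
  refine (mul_eq_zero.1 (?_ : (2 : ZMod p) * _ = 0)).resolve_left h2
  linear_combination key

end LogarithmicDerivative

/-! ### Reduction modulo `p` of the cyclotomic integers -/

section Reduction

open Polynomial NumberField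

variable {p : ℕ} [Fact p.Prime] {K : Type*} [Field K] [NumberField K]
  [IsCyclotomicExtension {p} ℚ K] {ζ : K} (hζ : IsPrimitiveRoot ζ p)

theorem cyclotomic_eq_X_sub_one_pow :
    cyclotomic p (ZMod p) = ((X : (ZMod p)[X]) - 1) ^ (p - 1) := by
  have hp := (Fact.out : p.Prime).pos
  have h0 : (X - 1 : (ZMod p)[X]) ≠ 0 := by
    simpa using X_sub_C_ne_zero (1 : ZMod p)
  refine mul_right_cancel₀ h0 ?_
  rw [cyclotomic_prime_mul_X_sub_one, ← X_sub_one_pow_char, ← pow_succ, Nat.sub_add_cancel hp]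

/-- The ring `𝔽_p[X] / (X - 1) ^ (p - 1)`, which is the ring of integers of the `p`-th cyclotomic
field modulo `p`. -/
abbrev ModPRing (p : ℕ) : Type := (ZMod p)[X] ⧸ Ideal.span {((X : (ZMod p)[X]) - 1) ^ (p - 1)}

/-- Evaluation at `X = 1`, i.e. reduction modulo the prime above `p`. -/
noncomputable def modPEval (p : ℕ) [Fact p.Prime] : ModPRing p →+* ZMod p :=
  Ideal.Quotient.lift _ (evalRingHom 1) fun a ha => by
    obtain ⟨b, rfl⟩ := Ideal.mem_span_singleton.1 ha
    have := Nat.sub_ne_zero_of_lt (Fact.out : p.Prime).one_lt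
    simp [this]

theorem modPEval_mk (f : (ZMod p)[X]) : modPEval p (Ideal.Quotient.mk _ f) = eval 1 f := rfl

instance : Nontrivial (ModPRing p) := (modPEval p).domain_nontrivial

instance : CharP (ModPRing p) p :=
  charP_of_injective_algebraMap (algebraMap (ZMod p) (ModPRing p)).injective p

/-- Reduction modulo `p` of the ring of integers, sending the root of unity to `X`. -/
noncomputable def reductionMap : 𝓞 K →ₐ[ℤ] ModPRing p :=
  hζ.integralPowerBasis.lift (Ideal.Quotient.mk _ X) (by
    have hmin : minpoly ℤ hζ.toInteger = cyclotomic p ℤ := by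
      rw [cyclotomic_eq_minpoly hζ (Fact.out : p.Prime).pos,
        ← minpoly.algebraMap_eq (RingOfIntegers.coe_injective (K := K)) hζ.toInteger]
      rfl
    rw [hζ.integralPowerBasis_gen, hmin, ← aeval_map_algebraMap (ZMod p)]
    have : aeval (Ideal.Quotient.mk (Ideal.span {((X : (ZMod p)[X]) - 1) ^ (p - 1)}) X)
        (cyclotomic p (ZMod p)) = Ideal.Quotient.mk _ (cyclotomic p (ZMod p)) := by
      rw [← Ideal.Quotient.mkₐ_eq_mk (ZMod p), aeval_algHom_apply, aeval_X_left_apply]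
    rw [map_cyclotomic, this, Ideal.Quotient.eq_zero_iff_mem, cyclotomic_eq_X_sub_one_pow]
    exact Ideal.mem_span_singleton_self _)

theorem reductionMap_toInteger :
    reductionMap hζ hζ.toInteger = Ideal.Quotient.mk _ X := by
  rw [reductionMap, ← hζ.integralPowerBasis_gen, PowerBasis.lift_gen]

theorem aeval_pow_char (f : ℤ[X]) {s : ModPRing p} (hs : s ^ p = 1) :
    (aeval s f) ^ p = Ideal.Quotient.mk _ (C ((f.eval 1 : ℤ) : ZMod p)) := by
  have h1 : frobenius (ModPRing p) p (aeval s f) = aeval (frobenius (ModPRing p) p s) f := by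
    rw [aeval_def, hom_eval₂, aeval_def]
    congr 1
    exact RingHom.ext_int _ _
  rw [frobenius_def, frobenius_def, hs] at h1
  rw [h1, aeval_def, eval₂_at_one]
  simp

/-- Complex conjugation on the ring of integers of a CM field. -/
noncomputable def intConj (K : Type*) [Field K] [NumberField K] [IsCMField K] : 𝓞 K ≃+* 𝓞 K :=
  RingOfIntegers.mapRingEquiv (IsCMField.complexConj K).toRingEquiv

omit [IsCyclotomicExtension {p} ℚ K] in
theorem intConj_toInteger [IsCMField K] :
    intConj K hζ.toInteger * hζ.toInteger = 1 := by
  have hz : hζ.toInteger ^ p = 1 := hζ.toInteger_isPrimitiveRoot.pow_eq_one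
  let v : (𝓞 K)ˣ := Units.ofPowEqOne _ p hz (Fact.out : p.Prime).ne_zero
  have hv : v ∈ Units.torsion K := by
    rw [Units.torsion, CommGroup.mem_torsion, isOfFinOrder_iff_pow_eq_one]
    exact ⟨p, (Fact.out : p.Prime).pos, Units.pow_ofPowEqOne _ _⟩
  have := congr_arg (fun w : (𝓞 K)ˣ => (w : 𝓞 K)) (IsCMField.unitsComplexConj_torsion K ⟨v, hv⟩)
  have h2 : intConj K hζ.toInteger = ((v⁻¹ : (𝓞 K)ˣ) : 𝓞 K) := this
  rw [h2]
  exact v.inv_mul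

/-- A `p`-th power and its complex conjugate are congruent to the same rational integer. -/
theorem exists_reductionMap_pow [IsCMField K] (γ : 𝓞 K) : ∃ g : ZMod p,
    reductionMap hζ γ ^ p = Ideal.Quotient.mk _ (C g) ∧
    reductionMap hζ (intConj K γ) ^ p = Ideal.Quotient.mk _ (C g) := by
  obtain ⟨f, hf⟩ := hζ.integralPowerBasis.exists_eq_aeval' γ
  rw [hζ.integralPowerBasis_gen] at hf
  have hz : hζ.toInteger ^ p = 1 := hζ.toInteger_isPrimitiveRoot.pow_eq_one
  refine ⟨((f.eval 1 : ℤ) : ZMod p), ?_, ?_⟩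
  · rw [hf, ← aeval_algHom_apply]
    refine aeval_pow_char f ?_
    rw [← map_pow, hz, map_one]
  · have : intConj K γ = aeval (intConj K hζ.toInteger) f := by
      rw [hf]
      exact (aeval_algHom_apply (intConj K : 𝓞 K →+* 𝓞 K).toIntAlgHom hζ.toInteger f).symm
    rw [this, ← aeval_algHom_apply]
    refine aeval_pow_char f ?_
    rw [← map_pow, ← map_pow, hz, map_one, map_one]

/-- Kronecker: a unit divided by its complex conjugate is `± ζ ^ k`. -/
theorem exists_unit_eq_mul_intConj [IsCMField K] (hp : 2 < p) (u : (𝓞 K)ˣ) :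
    ∃ (k : ℕ) (s : ℤ), (u : 𝓞 K) = s * hζ.toInteger ^ k * intConj K u := by
  have hodd : Odd p := (Fact.out : p.Prime).odd_of_ne_two (by omega)
  let w := IsCMField.unitsMulComplexConjInv K u
  have hw : (u : 𝓞 K) = ((w : (𝓞 K)ˣ) : 𝓞 K) * intConj K u := by
    have : (w : (𝓞 K)ˣ) * IsCMField.unitsComplexConj K u = u := by
      rw [IsCMField.unitsMulComplexConjInv_apply, inv_mul_cancel_right]
    exact (congr_arg (fun w : (𝓞 K)ˣ => (w : 𝓞 K)) this).symm
  have hfin : IsOfFinOrder (((w : (𝓞 K)ˣ) : 𝓞 K) : K) := by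
    have h1 : IsOfFinOrder (w : (𝓞 K)ˣ) := (CommGroup.mem_torsion _).1 w.2
    have h2 := (Units.coeHom (𝓞 K)).isOfFinOrder h1
    exact (algebraMap (𝓞 K) K).toMonoidHom.isOfFinOrder h2
  obtain ⟨k, -, hk | hk⟩ := hζ.exists_pow_or_neg_mul_pow_of_isOfFinOrder hodd hfin
  · refine ⟨k, 1, ?_⟩
    have : ((w : (𝓞 K)ˣ) : 𝓞 K) = hζ.toInteger ^ k := RingOfIntegers.ext hk
    simpa [this] using hw
  · refine ⟨k, -1, ?_⟩
    have : ((w : (𝓞 K)ˣ) : 𝓞 K) = -hζ.toInteger ^ k := RingOfIntegers.ext hk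
    simpa [this] using hw

omit [NumberField K] [IsCyclotomicExtension {p} ℚ K] in
theorem toInteger_pow_eq {a b : ℕ} (h : (a : ZMod p) = b) :
    hζ.toInteger ^ a = hζ.toInteger ^ b := by
  have hz : hζ.toInteger ^ p = 1 := hζ.toInteger_isPrimitiveRoot.pow_eq_one
  rw [pow_eq_pow_mod a hz, pow_eq_pow_mod b hz, (ZMod.natCast_eq_natCast_iff' a b p).1 h]

omit [IsCyclotomicExtension {p} ℚ K] in
theorem intConj_toInteger_pow [IsCMField K] (a : (ZMod p)ˣ) :
    intConj K hζ.toInteger ^ (a : ZMod p).val =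
      hζ.toInteger ^ ((-a : (ZMod p)ˣ) : ZMod p).val := by
  have h1 := congr_arg (· ^ (a : ZMod p).val) (intConj_toInteger hζ)
  simp only [mul_pow, one_pow] at h1
  have h2 : hζ.toInteger ^ ((-a : (ZMod p)ˣ) : ZMod p).val * hζ.toInteger ^ (a : ZMod p).val =
      1 := by
    rw [← pow_add, ← pow_zero hζ.toInteger]
    refine toInteger_pow_eq hζ ?_
    simp
  have h3 : hζ.toInteger ^ (a : ZMod p).val ≠ 0 :=
    pow_ne_zero _ (hζ.toInteger_isPrimitiveRoot.ne_zero (Fact.out : p.Prime).ne_zero)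
  exact mul_right_cancel₀ h3 (h1.trans h2.symm)

/-- If a product of conjugates of `x + y ζ` is a unit times a `p`-th power, then dividing by the
complex conjugate removes the unknown unit, and logarithmic differentiation applies. -/
theorem mirimanoffValue_mul_sum_eq_zero_of_prod_eq (hp : 2 < p) {x y : ℤ}
    (hy : (y : ZMod p) ≠ 0) (hxy : (x : ZMod p) + y ≠ 0) (n : (ZMod p)ˣ → ℕ) (u : (𝓞 K)ˣ) (γ : 𝓞 K)
    (h : ∏ a : (ZMod p)ˣ, ((x : 𝓞 K) + y * hζ.toInteger ^ (a : ZMod p).val) ^ n a = u * γ ^ p)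
    {m : ℕ} (hm : 1 ≤ m) (hm' : m ≤ (p - 3) / 2) :
    mirimanoffValue p (2 * m) (-(x : ZMod p) / y) *
      ∑ a : (ZMod p)ˣ, (n a : ZMod p) * (a : ZMod p) ^ (2 * m + 1) = 0 := by
  have : IsCMField K := IsCyclotomicExtension.Rat.isCMField K (S := {p}) ⟨p, rfl, hp⟩
  have hconj : ∏ a : (ZMod p)ˣ,
      ((x : 𝓞 K) + y * hζ.toInteger ^ ((-a : (ZMod p)ˣ) : ZMod p).val) ^ n a =
      intConj K u * intConj K γ ^ p := by
    have := congr_arg (intConj K) h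
    simpa only [map_prod, map_mul, map_pow, map_add, map_intCast, intConj_toInteger_pow] using this
  obtain ⟨k, s, hu⟩ := exists_unit_eq_mul_intConj hζ hp u
  obtain ⟨g, hg1, hg2⟩ := exists_reductionMap_pow hζ γ
  set t : ZMod p := -(x : ZMod p) / y with ht
  have hyt : (y : ZMod p) * t = -x := by rw [ht]; field_simp
  have ht1 : t ≠ 1 := by
    intro h1
    rw [h1] at hyt
    exact hxy (by linear_combination hyt)
  let P (f : (ZMod p)ˣ → ℕ) : (ZMod p)[X] := ∏ a : (ZMod p)ˣ, (X ^ f a - C t) ^ n a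
  let c : ZMod p := ∏ a : (ZMod p)ˣ, (y : ZMod p) ^ n a
  have hc : c ≠ 0 := Finset.prod_ne_zero_iff.2 fun a _ => pow_ne_zero _ hy
  have hred : ∀ f : (ZMod p)ˣ → ℕ,
      reductionMap hζ (∏ a, ((x : 𝓞 K) + y * hζ.toInteger ^ f a) ^ n a) =
        Ideal.Quotient.mk _ (C c * P f) := by
    intro f
    rw [map_prod (C : ZMod p →+* (ZMod p)[X]), ← Finset.prod_mul_distrib, map_prod, map_prod]
    refine Finset.prod_congr rfl fun a _ => ?_
    rw [C_pow, ← mul_pow, map_pow, map_pow]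
    congr 1
    rw [mul_sub, ← C_mul, hyt]
    simp [reductionMap_toInteger, add_comm]
  have hg : g ≠ 0 := by
    rintro rfl
    have h0 := congr_arg (reductionMap hζ) h
    rw [hred, map_mul (reductionMap hζ), map_pow, hg1, C_0, map_zero, mul_zero] at h0
    have := congr_arg (modPEval p) h0
    rw [modPEval_mk, map_zero] at this
    simp only [eval_mul, eval_C, mul_eq_zero, hc, false_or, P,
      eval_prod, Finset.prod_eq_zero_iff] at this
    obtain ⟨a, -, ha⟩ := this
    simp only [eval_pow, eval_sub, eval_X, one_pow, eval_C] at ha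
    exact sub_ne_zero.2 ht1.symm (eq_zero_of_pow_eq_zero ha)
  have key : (∏ a : (ZMod p)ˣ, ((x : 𝓞 K) + y * hζ.toInteger ^ (a : ZMod p).val) ^ n a) *
      intConj K γ ^ p = s * hζ.toInteger ^ k * (∏ a : (ZMod p)ˣ,
      ((x : 𝓞 K) + y * hζ.toInteger ^ ((-a : (ZMod p)ˣ) : ZMod p).val) ^ n a) * γ ^ p := by
    rw [h, hconj]
    linear_combination (γ ^ p * intConj K γ ^ p) * hu
  have key2 := congr_arg (reductionMap hζ) key
  rw [map_mul, map_mul, map_mul, map_mul, hred, hred, map_pow, map_pow, map_pow, hg1, hg2,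
    reductionMap_toInteger, map_intCast, 
    ← map_intCast (Ideal.Quotient.mk (Ideal.span {((X : (ZMod p)[X]) - 1) ^ (p - 1)})), ← map_pow,
    ← map_mul, ← map_mul, ← map_mul, ← map_mul, Ideal.Quotient.eq, Ideal.mem_span_singleton] at key2
  refine mirimanoffValue_mul_sum_eq_zero hp ht1 n k s ?_ hm hm'
  have hunit : IsUnit (C (c * g)) := isUnit_C.2 (mul_ne_zero hc hg).isUnit
  rw [← hunit.dvd_mul_right]
  convert key2 using 1
  simp only [C_mul, P, map_intCast]
  ring

end Reduction

/-! ### Jacobi sums and Stickelberger's relation -/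

section Galois

open Polynomial NumberField

variable {p : ℕ} [Fact p.Prime] {K : Type*} [Field K] [NumberField K]
  [IsCyclotomicExtension {p} ℚ K] {ζ : K} (hζ : IsPrimitiveRoot ζ p)

/-- The automorphism `ζ ↦ ζ ^ a` of the ring of integers of the `p`-th cyclotomic field. -/
noncomputable def cycloAut (K : Type*) [Field K] [NumberField K] [IsCyclotomicExtension {p} ℚ K]
    (a : (ZMod p)ˣ) : 𝓞 K ≃+* 𝓞 K :=
  RingOfIntegers.mapRingEquiv
    ((IsCyclotomicExtension.Rat.galEquivZMod p K).symm a).toRingEquiv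

theorem cycloAut_of_pow_eq_one (a : (ZMod p)ˣ) {v : 𝓞 K} (hv : v ^ p = 1) :
    cycloAut K a v = v ^ (a : ZMod p).val := by
  have hv' : (v : K) ^ p = 1 := by
    rw [← map_pow, hv, map_one]
  refine RingOfIntegers.ext ?_
  have := IsCyclotomicExtension.Rat.galEquivZMod_apply_of_pow_eq p K
    ((IsCyclotomicExtension.Rat.galEquivZMod p K).symm a) hv'
  rw [MulEquiv.apply_symm_apply] at this
  exact this

theorem cycloAut_mul (a b : (ZMod p)ˣ) (x : 𝓞 K) :
    cycloAut K (a * b) x = cycloAut K a (cycloAut K b x) := by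
  refine RingOfIntegers.ext ?_
  simp [cycloAut, RingOfIntegers.mapRingEquiv_apply, map_mul]

theorem cycloAut_one (x : 𝓞 K) : cycloAut K (1 : (ZMod p)ˣ) x = x :=
  (cycloAut K (1 : (ZMod p)ˣ)).injective (by rw [← cycloAut_mul, one_mul])

theorem mem_map_cycloAut_inv {a : (ZMod p)ˣ} {I : Ideal (𝓞 K)} {x : 𝓞 K} :
    x ∈ I.map (cycloAut K a⁻¹) ↔ cycloAut K a x ∈ I := by
  rw [Ideal.mem_map_of_equiv]
  constructor
  · rintro ⟨y, hy, rfl⟩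
    rwa [← cycloAut_mul, mul_inv_cancel, cycloAut_one]
  · intro h
    exact ⟨_, h, by rw [← cycloAut_mul, inv_mul_cancel, cycloAut_one]⟩

variable {q : ℕ} [Fact q.Prime] (φ : 𝓞 K →+* ZMod q)

theorem ringHom_zmod_surjective {R : Type*} [Ring R] (φ : R →+* ZMod q) :
    Function.Surjective φ := by
  intro b
  obtain ⟨n, rfl⟩ := ZMod.intCast_surjective b
  exact ⟨n, by simp⟩

omit [NumberField K] [IsCyclotomicExtension {p} ℚ K] in
/-- The root of unity stays primitive in every residue ring in which `p ≠ 0`, because the sum of its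
powers vanishes. -/
theorem isPrimitiveRoot_map_toInteger {R : Type*} [CommRing R] (φ : 𝓞 K →+* R)
    (hR : (p : R) ≠ 0) : IsPrimitiveRoot (φ hζ.toInteger) p := by
  have hz : hζ.toInteger ^ p = 1 := hζ.toInteger_isPrimitiveRoot.pow_eq_one
  rw [IsPrimitiveRoot.iff_orderOf]
  refine orderOf_eq_prime (by rw [← map_pow, hz, map_one]) fun h1 => hR ?_
  have hs := hζ.toInteger_isPrimitiveRoot.geom_sum_eq_zero (Fact.out : p.Prime).one_lt
  simpa [h1] using congr_arg φ hs

theorem natCast_zmod_ne_zero_of_ne (hq : q ≠ p) : (p : ZMod q) ≠ 0 :=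
  natCast_zmod_ne_zero_of_coprime ((Nat.coprime_primes Fact.out Fact.out).2 hq.symm)

theorem map_cycloAut_ker_isMaximal (a : (ZMod p)ˣ) :
    ((RingHom.ker φ).map (cycloAut K a⁻¹)).IsMaximal := by
  have : (RingHom.ker φ).map (cycloAut K a⁻¹) =
      RingHom.ker (φ.comp (cycloAut K a : 𝓞 K →+* 𝓞 K)) := by
    ext x
    rw [mem_map_cycloAut_inv, RingHom.mem_ker, RingHom.mem_ker]
    rfl
  rw [this]
  exact RingHom.ker_isMaximal_of_surjective _ (ringHom_zmod_surjective _)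

theorem absNorm_map_cycloAut_ker (a : (ZMod p)ˣ) :
    Ideal.absNorm ((RingHom.ker φ).map (cycloAut K a⁻¹)) = q := by
  have : (RingHom.ker φ).map (cycloAut K a⁻¹) =
      RingHom.ker (φ.comp (cycloAut K a : 𝓞 K →+* 𝓞 K)) := by
    ext x
    rw [mem_map_cycloAut_inv, RingHom.mem_ker, RingHom.mem_ker]
    rfl
  rw [this, Ideal.absNorm_apply, Submodule.cardQuot_apply]
  exact (Nat.card_congr (RingHom.quotientKerEquivOfSurjective
    (ringHom_zmod_surjective (φ.comp (cycloAut K a : 𝓞 K →+* 𝓞 K)))).toEquiv).trans (Nat.card_zmod q)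

include hζ in
theorem map_cycloAut_ker_injective (hq : q ≠ p) {a b : (ZMod p)ˣ}
    (h : (RingHom.ker φ).map (cycloAut K a⁻¹) = (RingHom.ker φ).map (cycloAut K b⁻¹)) : a = b := by
  have hz : hζ.toInteger ^ p = 1 := hζ.toInteger_isPrimitiveRoot.pow_eq_one
  obtain ⟨n, hn⟩ := ZMod.intCast_surjective (φ hζ.toInteger ^ (a : ZMod p).val)
  have mem : ∀ c : (ZMod p)ˣ, hζ.toInteger - n ∈ (RingHom.ker φ).map (cycloAut K c⁻¹) ↔
      φ hζ.toInteger ^ (c : ZMod p).val = φ hζ.toInteger ^ (a : ZMod p).val := by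
    intro c
    rw [mem_map_cycloAut_inv, map_sub, map_intCast, cycloAut_of_pow_eq_one _ hz, RingHom.mem_ker,
      map_sub, map_intCast, map_pow, sub_eq_zero, hn]
  have hb := (mem b).1 (h ▸ (mem a).2 rfl)
  have := (isPrimitiveRoot_map_toInteger hζ φ (natCast_zmod_ne_zero_of_ne hq)).pow_inj (ZMod.val_lt _) (ZMod.val_lt _) hb
  exact Units.ext (ZMod.val_injective p this.symm)

theorem eq_of_dvd_of_absNorm_eq {I J : Ideal (𝓞 K)} (h : I ∣ J)
    (hN : Ideal.absNorm I = Ideal.absNorm J) (h0 : Ideal.absNorm J ≠ 0) : I = J := by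
  obtain ⟨C, rfl⟩ := h
  rw [map_mul] at hN h0
  have : Ideal.absNorm C = 1 := by
    have h1 := left_ne_zero_of_mul h0
    exact mul_left_cancel₀ h1 (by rw [← hN, mul_one])
  rw [Ideal.absNorm_eq_one_iff.1 this, Ideal.mul_top]

include hζ in
/-- A prime of residue degree one away from `p` splits completely. -/
theorem prod_map_cycloAut_ker (hq : q ≠ p) :
    ∏ a : (ZMod p)ˣ, (RingHom.ker φ).map (cycloAut K a⁻¹) = Ideal.span {(q : 𝓞 K)} := by
  have hfin : Module.finrank ℤ (𝓞 K) = p - 1 := by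
    rw [RingOfIntegers.rank, IsCyclotomicExtension.Rat.finrank p K,
      Nat.totient_prime (Fact.out : p.Prime)]
  refine eq_of_dvd_of_absNorm_eq ?_ ?_ ?_
  · refine Finset.prod_dvd_of_coprime (fun a _ b _ hab => ?_) fun a _ => ?_
    · have := map_cycloAut_ker_isMaximal φ a
      have := map_cycloAut_ker_isMaximal φ b
      exact Ideal.isCoprime_of_isMaximal fun h => hab (map_cycloAut_ker_injective hζ φ hq h)
    · rw [Ideal.dvd_span_singleton, mem_map_cycloAut_inv, RingHom.mem_ker]
      simp
  · simp_rw [map_prod, absNorm_map_cycloAut_ker]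
    rw [Finset.prod_const, Ideal.absNorm_span_natCast, hfin, Finset.card_univ, ZMod.card_units]
  · rw [Ideal.absNorm_span_natCast]
    exact pow_ne_zero _ (Fact.out : q.Prime).ne_zero

omit [NumberField K] [IsCyclotomicExtension {p} ℚ K] in
include hζ in
/-- The power residue character of order `p` modulo a prime of degree one. -/
theorem exists_powerResidueChar (hq : q ≠ p) : ∃ (s : ℕ) (χ : MulChar (ZMod q) (𝓞 K)),
    0 < s ∧ s * p = q - 1 ∧ χ ^ p = 1 ∧ ∀ a, φ (χ a) = a ^ s := by
  have hw := isPrimitiveRoot_map_toInteger hζ φ (natCast_zmod_ne_zero_of_ne hq)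
  have hz : hζ.toInteger ^ p = 1 := hζ.toInteger_isPrimitiveRoot.pow_eq_one
  have hw0 : φ hζ.toInteger ≠ 0 := hw.ne_zero (Fact.out : p.Prime).ne_zero
  obtain ⟨s, hs⟩ : p ∣ q - 1 := by
    rw [hw.eq_orderOf]
    exact ZMod.orderOf_dvd_card_sub_one hw0
  rw [mul_comm] at hs
  have hs0 : 0 < s := by
    rcases Nat.eq_zero_or_pos s with h | h
    · have := (Fact.out : q.Prime).one_lt
      rw [h] at hs; omega
    · exact h
  have ex : ∀ u : (ZMod q)ˣ, ∃ i < p, φ hζ.toInteger ^ i = (u : ZMod q) ^ s := fun u => by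
    refine hw.eq_pow_of_pow_eq_one ?_
    rw [← pow_mul, ← hs, ZMod.pow_card_sub_one_eq_one u.ne_zero]
  choose f hf using ex
  let v : (𝓞 K)ˣ := Units.ofPowEqOne _ p hz (Fact.out : p.Prime).ne_zero
  have hv : v ^ p = 1 := Units.pow_ofPowEqOne _ _
  have hinj : ∀ i j : ℕ, φ hζ.toInteger ^ i = φ hζ.toInteger ^ j → v ^ i = v ^ j := by
    intro i j h
    rw [pow_eq_pow_mod i hv, pow_eq_pow_mod j hv]
    rw [pow_eq_pow_mod i hw.pow_eq_one, pow_eq_pow_mod j hw.pow_eq_one] at h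
    have hp := (Fact.out : p.Prime).pos
    rw [hw.pow_inj (Nat.mod_lt _ hp) (Nat.mod_lt _ hp) h]
  let χ₀ : (ZMod q)ˣ →* (𝓞 K)ˣ := MonoidHom.mk' (fun u => v ^ f u) fun a b => by
    rw [← pow_add]
    refine hinj _ _ ?_
    rw [pow_add, (hf _).2, (hf _).2, (hf _).2, Units.val_mul, mul_pow]
  refine ⟨s, MulChar.ofUnitHom χ₀, hs0, hs.symm, ?_, fun a => ?_⟩
  · refine MulChar.ext fun u => ?_
    rw [MulChar.pow_apply_coe, MulChar.ofUnitHom_coe, MulChar.one_apply_coe]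
    have : (χ₀ u) ^ p = 1 := by
      change (v ^ f u) ^ p = 1
      rw [pow_right_comm, hv, one_pow]
    rw [← Units.val_pow_eq_pow_val, this, Units.val_one]
  · by_cases ha : a = 0
    · subst ha
      rw [MulChar.map_zero, map_zero, zero_pow hs0.ne']
    · obtain ⟨u, rfl⟩ := (isUnit_iff_ne_zero.2 ha)
      rw [MulChar.ofUnitHom_coe, ← (hf u).2, ← map_pow]
      rfl

variable {χ : MulChar (ZMod q) (𝓞 K)} {s : ℕ}

omit [NumberField K] [IsCyclotomicExtension {p} ℚ K] [Fact q.Prime] in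
theorem mulChar_pow_eq_of_natCast_eq (hχ : χ ^ p = 1) {a b : ℕ} (h : (a : ZMod p) = b) :
    χ ^ a = χ ^ b := by
  rw [pow_eq_pow_mod a hχ, pow_eq_pow_mod b hχ, (ZMod.natCast_eq_natCast_iff' a b p).1 h]

theorem cycloAut_jacobiSum (hχ : χ ^ p = 1) (j : (ZMod p)ˣ) (α β : ZMod p) :
    cycloAut K j (jacobiSum (χ ^ α.val) (χ ^ β.val)) =
      jacobiSum (χ ^ (j * α).val) (χ ^ (j * β).val) := by
  have key : ∀ γ : ZMod p, (χ ^ γ.val).ringHomComp (cycloAut K j : 𝓞 K →+* 𝓞 K) =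
      χ ^ (j * γ).val := by
    intro γ
    have h1 : χ ^ (j * γ).val = χ ^ (γ.val * (j : ZMod p).val) :=
      mulChar_pow_eq_of_natCast_eq hχ (by simp [mul_comm])
    refine MulChar.ext fun u => ?_
    rw [h1, MulChar.ringHomComp_apply, pow_mul, MulChar.pow_apply_coe _ (j : ZMod p).val]
    refine cycloAut_of_pow_eq_one j ?_
    rw [← MulChar.pow_apply_coe, ← pow_mul, mul_comm, pow_mul, hχ, one_pow, MulChar.one_apply_coe]
  rw [← key, ← key, jacobiSum_ringHomComp]
  rfl

omit [NumberField K] [IsCyclotomicExtension {p} ℚ K] in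
/-- The polynomial `x ^ k (1 - x) ^ l` has degree less than `q - 1`, so its values over the prime
field add up to zero. -/
theorem map_jacobiSum_eq_zero (hs : s * p = q - 1) (hs0 : 0 < s)
    (hφ : ∀ a, φ (χ a) = a ^ s) {α β : ZMod p} (hα : α ≠ 0) (hβ : β ≠ 0)
    (h : α.val + β.val < p) : φ (jacobiSum (χ ^ α.val) (χ ^ β.val)) = 0 := by
  have hα' : α.val ≠ 0 := (ZMod.val_ne_zero α).2 hα
  have hβ' : β.val ≠ 0 := (ZMod.val_ne_zero β).2 hβ
  have h1 : φ (jacobiSum (χ ^ α.val) (χ ^ β.val)) =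
      ∑ x : ZMod q, x ^ (s * α.val) * (1 - x) ^ (s * β.val) := by
    rw [jacobiSum, map_sum]
    refine Finset.sum_congr rfl fun x _ => ?_
    rw [map_mul, MulChar.pow_apply' _ hα', MulChar.pow_apply' _ hβ', map_pow, map_pow, hφ, hφ,
      ← pow_mul, ← pow_mul]
  set f : (ZMod q)[X] := X ^ (s * α.val) * (1 - X) ^ (s * β.val) with hf
  have hdeg : f.natDegree < q - 1 := by
    have h2 : f.natDegree ≤ s * α.val + s * β.val := by
      refine natDegree_mul_le.trans (add_le_add (natDegree_X_pow_le _) ?_)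
      refine natDegree_pow_le.trans ?_
      have : (1 - X : (ZMod q)[X]).natDegree ≤ 1 := by compute_degree
      calc _ ≤ s * β.val * 1 := Nat.mul_le_mul_left _ this
        _ = _ := mul_one _
    calc f.natDegree ≤ s * (α.val + β.val) := by rw [mul_add]; exact h2
      _ < s * p := Nat.mul_lt_mul_of_pos_left h hs0
      _ = q - 1 := hs
  have h3 : ∀ x : ZMod q, x ^ (s * α.val) * (1 - x) ^ (s * β.val) = f.eval x := by
    intro x; simp [hf]
  rw [h1]
  simp_rw [h3, eval_eq_sum_range]
  rw [Finset.sum_comm]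
  refine Finset.sum_eq_zero fun i hi => ?_
  rw [← Finset.mul_sum, FiniteField.sum_pow_lt_card_sub_one, mul_zero]
  rw [ZMod.card]
  rw [Finset.mem_range] at hi
  omega

omit [IsCyclotomicExtension {p} ℚ K] in
theorem jacobiSum_mul_jacobiSum_neg (hs : s * p = q - 1) (hs0 : 0 < s) (hχ : χ ^ p = 1)
    (hφ : ∀ a, φ (χ a) = a ^ s) {α β : ZMod p} (hα : α ≠ 0) (hβ : β ≠ 0) (hαβ : α + β ≠ 0) :
    jacobiSum (χ ^ α.val) (χ ^ β.val) * jacobiSum (χ ^ (-α).val) (χ ^ (-β).val) = q := by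
  have ne : ∀ {γ : ZMod p}, γ ≠ 0 → χ ^ γ.val ≠ 1 := by
    intro γ hγ h
    -- Otherwise every non-zero `u` satisfies `u ^ (s γ) = 1` with `0 < s γ < q - 1`.
    have hγ' : γ.val ≠ 0 := (ZMod.val_ne_zero γ).2 hγ
    have h1 : ∀ u : (ZMod q)ˣ, u ^ (s * γ.val) = 1 := by
      intro u
      have h2 := congr_arg φ (congr_arg (fun ψ : MulChar (ZMod q) (𝓞 K) => ψ u) h)
      simp only [MulChar.pow_apply_coe, MulChar.one_apply_coe, map_pow, map_one, hφ] at h2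
      refine Units.ext ?_
      rw [Units.val_pow_eq_pow_val, pow_mul, h2, Units.val_one]
    have h2 := (FiniteField.forall_pow_eq_one_iff (ZMod q) (s * γ.val)).1 h1
    rw [ZMod.card, ← hs] at h2
    have h3 := Nat.le_of_dvd (Nat.mul_pos hs0 (Nat.pos_of_ne_zero hγ')) h2
    exact absurd (Nat.le_of_mul_le_mul_left h3 hs0) (not_le.2 (ZMod.val_lt γ))
  have inv : ∀ γ : ZMod p, χ ^ (-γ).val = (χ ^ γ.val)⁻¹ := by
    intro γ
    rw [eq_inv_iff_mul_eq_one, ← pow_add, ← pow_zero χ]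
    exact mulChar_pow_eq_of_natCast_eq hχ (by simp)
  have hmul : χ ^ α.val * χ ^ β.val ≠ 1 := by
    rw [← pow_add, mulChar_pow_eq_of_natCast_eq hχ (b := (α + β).val) (by simp)]
    exact ne hαβ
  have hinj := RingOfIntegers.coe_injective (K := K)
  have hchar : ringChar K ≠ ringChar (ZMod q) := by
    rw [ringChar.eq_zero, ZMod.ringChar_zmod_n]
    exact (Fact.out : q.Prime).ne_zero.symm
  have key := jacobiSum_mul_jacobiSum_inv (F := ZMod q) (F' := K) hchar
    (χ := (χ ^ α.val).ringHomComp (algebraMap (𝓞 K) K))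
    (φ := (χ ^ β.val).ringHomComp (algebraMap (𝓞 K) K))
    ((MulChar.ringHomComp_ne_one_iff hinj).2 (ne hα))
    ((MulChar.ringHomComp_ne_one_iff hinj).2 (ne hβ))
    (by
      rw [← MulChar.ringHomComp_mul]
      exact (MulChar.ringHomComp_ne_one_iff hinj).2 hmul)
  rw [MulChar.ringHomComp_inv, MulChar.ringHomComp_inv, jacobiSum_ringHomComp,
    jacobiSum_ringHomComp, ZMod.card] at key
  rw [inv, inv]
  refine hinj ?_
  rw [map_mul, key, map_natCast]

open Classical in
/-- The `j` such that the representatives in `[0, p[` of `j α` and `j β` add up to less than `p`. -/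
noncomputable def smallSumSet (α β : ZMod p) : Finset (ZMod p)ˣ :=
  Finset.univ.filter fun j => (j * α : ZMod p).val + (j * β : ZMod p).val < p

theorem neg_mem_smallSumSet {α β : ZMod p} (hα : α ≠ 0) (hβ : β ≠ 0) (hαβ : α + β ≠ 0)
    (j : (ZMod p)ˣ) : -j ∈ smallSumSet α β ↔ j ∉ smallSumSet α β := by
  have h1 : (j : ZMod p) * α ≠ 0 := mul_ne_zero j.ne_zero hα
  have h2 : (j : ZMod p) * β ≠ 0 := mul_ne_zero j.ne_zero hβ
  have h3 : ((j : ZMod p) * α).val + ((j : ZMod p) * β).val ≠ p := by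
    intro h
    have := congr_arg (Nat.cast : ℕ → ZMod p) h
    simp only [Nat.cast_add, ZMod.natCast_zmod_val, CharP.cast_eq_zero, ← mul_add] at this
    exact mul_ne_zero j.ne_zero hαβ this
  simp only [smallSumSet, Finset.mem_filter, Finset.mem_univ, true_and, Units.val_neg, neg_mul]
  have : NeZero ((j : ZMod p) * α) := ⟨h1⟩
  have : NeZero ((j : ZMod p) * β) := ⟨h2⟩
  rw [ZMod.val_neg_of_ne_zero, ZMod.val_neg_of_ne_zero]
  have := ZMod.val_lt ((j : ZMod p) * α)
  have := ZMod.val_lt ((j : ZMod p) * β)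
  omega

include hζ in
/-- Stickelberger's relation for a prime of degree one: the product of its conjugates indexed by
`smallSumSet` is generated by a Jacobi sum. -/
theorem isPrincipal_prod_map_cycloAut_ker (hq : q ≠ p) {α β : ZMod p} (hα : α ≠ 0) (hβ : β ≠ 0)
    (hαβ : α + β ≠ 0) :
    (∏ j ∈ smallSumSet α β, (RingHom.ker φ).map (cycloAut K j⁻¹)).IsPrincipal := by
  classical
  obtain ⟨s, χ, hs0, hs, hχ, hφ⟩ := exists_powerResidueChar hζ φ hq
  have dvd : ∀ {α β : ZMod p}, α ≠ 0 → β ≠ 0 →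
      ∏ j ∈ smallSumSet α β, (RingHom.ker φ).map (cycloAut K j⁻¹) ∣
        Ideal.span {jacobiSum (χ ^ α.val) (χ ^ β.val)} := by
    intro α β hα hβ
    refine Finset.prod_dvd_of_coprime (fun a _ b _ hab => ?_) fun j hj => ?_
    · have := map_cycloAut_ker_isMaximal φ a
      have := map_cycloAut_ker_isMaximal φ b
      exact Ideal.isCoprime_of_isMaximal fun h => hab (map_cycloAut_ker_injective hζ φ hq h)
    · rw [Ideal.dvd_span_singleton, mem_map_cycloAut_inv, RingHom.mem_ker, cycloAut_jacobiSum hχ]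
      exact map_jacobiSum_eq_zero φ hs hs0 hφ (mul_ne_zero j.ne_zero hα)
        (mul_ne_zero j.ne_zero hβ) (by simpa [smallSumSet] using hj)
  obtain ⟨C, hC⟩ := dvd hα hβ
  obtain ⟨D, hD⟩ := dvd (neg_ne_zero.2 hα) (neg_ne_zero.2 hβ)
  have hcompl : smallSumSet (-α) (-β) = (smallSumSet α β)ᶜ := by
    ext j
    rw [Finset.mem_compl, ← neg_mem_smallSumSet hα hβ hαβ]
    simp [smallSumSet]
  have hprod : Ideal.span {jacobiSum (χ ^ α.val) (χ ^ β.val)} *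
      Ideal.span {jacobiSum (χ ^ (-α).val) (χ ^ (-β).val)} = Ideal.span {(q : 𝓞 K)} := by
    rw [Ideal.span_singleton_mul_span_singleton,
      jacobiSum_mul_jacobiSum_neg φ hs hs0 hχ hφ hα hβ hαβ]
  have hq0 : Ideal.span {(q : 𝓞 K)} ≠ 0 := by
    rw [Ne, Ideal.zero_eq_bot, Ideal.span_singleton_eq_bot]
    exact_mod_cast (Fact.out : q.Prime).ne_zero
  have hCD : C * D = 1 := by
    refine mul_left_cancel₀ hq0 ?_
    calc Ideal.span {(q : 𝓞 K)} * (C * D)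
        = (∏ j ∈ smallSumSet α β, (RingHom.ker φ).map (cycloAut K j⁻¹)) * C *
          ((∏ j ∈ (smallSumSet α β)ᶜ, (RingHom.ker φ).map (cycloAut K j⁻¹)) * D) := by
          rw [← prod_map_cycloAut_ker hζ φ hq, ← Finset.prod_mul_prod_compl (smallSumSet α β)]
          ring
      _ = Ideal.span {(q : 𝓞 K)} * 1 := by rw [mul_one, ← hprod, hC, hD, hcompl]
  have hC1 : C = 1 := by
    have := IsUnit.of_mul_eq_one D hCD
    rwa [Ideal.isUnit_iff, ← Ideal.one_eq_top] at this
  rw [hC1, mul_one] at hC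
  rw [← hC]
  exact ⟨⟨_, rfl⟩⟩

end Galois

/-! ### The ideals attached to a solution and the class group -/

section Descent

open Polynomial NumberField

variable {p : ℕ} [Fact p.Prime] {K : Type*} [Field K] [NumberField K]
  [IsCyclotomicExtension {p} ℚ K] {ζ : K} (hζ : IsPrimitiveRoot ζ p)

omit [NumberField K] [IsCyclotomicExtension {p} ℚ K] in
theorem prod_pow_toInteger_eq (hp : 2 < p) (x y : 𝓞 K) :
    ∏ a : ZMod p, (x + y * hζ.toInteger ^ a.val) = x ^ p + y ^ p := by
  have hprim := hζ.toInteger_isPrimitiveRoot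
  have hpos := (Fact.out : p.Prime).pos
  rw [hprim.pow_add_pow_eq_prod_add_mul _ _ ((Fact.out : p.Prime).odd_of_ne_two (by omega))]
  refine Finset.prod_nbij (fun a : ZMod p => hζ.toInteger ^ a.val) (fun a _ => ?_)
    (fun a _ b _ hab => ?_) (fun w hw => ?_) fun a _ => ?_
  · rw [Polynomial.mem_nthRootsFinset hpos, pow_right_comm, hprim.pow_eq_one, one_pow]
  · exact ZMod.val_injective p (hprim.pow_inj (ZMod.val_lt _) (ZMod.val_lt _) hab)
  · obtain ⟨i, hi, rfl⟩ := hprim.eq_pow_of_pow_eq_one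
      ((Polynomial.mem_nthRootsFinset hpos _).1 hw)
    exact ⟨(i : ZMod p), by simp, by simp [ZMod.val_cast_of_lt hi]⟩
  · rw [mul_comm]

section PrimeFactors

variable {x y : ℤ} {P : Ideal (𝓞 K)} [P.IsPrime] {i : ℕ}
  (hcop : IsCoprime x y) (hP : (x : 𝓞 K) + y * hζ.toInteger ^ i ∈ P)

omit [NumberField K] [IsCyclotomicExtension {p} ℚ K] in
include hP hcop in
theorem intCast_notMem_of_add_mem : (y : 𝓞 K) ∉ P := by
  intro hy
  have hx : (x : 𝓞 K) ∈ P := by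
    have := P.sub_mem hP (P.mul_mem_right (hζ.toInteger ^ i) hy)
    simpa using this
  obtain ⟨a, b, hab⟩ := hcop
  refine (Ideal.ne_top_iff_one P).1 Ideal.IsPrime.ne_top' ?_
  have := P.add_mem (P.mul_mem_left (a : 𝓞 K) hx) (P.mul_mem_left (b : 𝓞 K) hy)
  rwa [← Int.cast_mul, ← Int.cast_mul, ← Int.cast_add, hab, Int.cast_one] at this

omit [NumberField K] [IsCyclotomicExtension {p} ℚ K] in
include hP in
/-- A prime factor of `x + y ζ ^ i` lies away from `p`: modulo the prime above `p` one has `ζ = 1`,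
and `p` does not divide `x + y`. -/
theorem natCast_notMem_of_add_mem (hxy : ¬ (p : ℤ) ∣ x + y) : (p : 𝓞 K) ∉ P := by
  intro hp
  have hz : hζ.toInteger ^ p = 1 := hζ.toInteger_isPrimitiveRoot.pow_eq_one
  let π := Ideal.Quotient.mk P
  have hp0 : (p : 𝓞 K ⧸ P) = 0 := by
    rw [← map_natCast π]
    exact Ideal.Quotient.eq_zero_iff_mem.2 hp
  have : CharP (𝓞 K ⧸ P) p := by
    refine CharP.congr (ringChar (𝓞 K ⧸ P)) ?_
    have h1 := ringChar.dvd hp0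
    exact ((Nat.dvd_prime Fact.out).1 h1).resolve_left (CharP.ringChar_ne_one)
  have h1 : π hζ.toInteger = 1 := by
    have : (π hζ.toInteger - 1) ^ p = 0 := by
      rw [sub_pow_char, ← map_pow, hz, map_one, one_pow, sub_self]
    exact sub_eq_zero.1 (eq_zero_of_pow_eq_zero this)
  have h2 : ((x + y : ℤ) : 𝓞 K ⧸ P) = 0 := by
    have := Ideal.Quotient.eq_zero_iff_mem.2 hP
    simpa [π, h1] using this
  exact hxy ((CharP.intCast_eq_zero_iff (𝓞 K ⧸ P) p _).1 h2)

include hP hcop in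
/-- A prime factor of `x + y ζ ^ i` has residue degree one, because `ζ ^ i` is congruent to the
rational number `-x / y`. -/
theorem exists_ringHom_zmod_of_add_mem (hxy : ¬ (p : ℤ) ∣ x + y) (hP0 : P ≠ ⊥)
    (hi : (i : ZMod p) ≠ 0) :
    ∃ (q : ℕ) (_ : Fact q.Prime) (φ : 𝓞 K →+* ZMod q), q ≠ p ∧ RingHom.ker φ = P := by
  have hz : hζ.toInteger ^ p = 1 := hζ.toInteger_isPrimitiveRoot.pow_eq_one
  have hmax : P.IsMaximal := ‹P.IsPrime›.isMaximal hP0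
  let : Field (𝓞 K ⧸ P) := Ideal.Quotient.field P
  have : Finite (𝓞 K ⧸ P) := Ideal.finiteQuotientOfFreeOfNeBot P hP0
  let q := ringChar (𝓞 K ⧸ P)
  have hq : Fact q.Prime := ⟨CharP.char_is_prime (𝓞 K ⧸ P) q⟩
  let π := Ideal.Quotient.mk P
  let ψ : ZMod q →+* 𝓞 K ⧸ P := ZMod.castHom dvd_rfl _
  have hy : (y : 𝓞 K ⧸ P) ≠ 0 := by
    rw [← map_intCast π]
    exact fun h => intCast_notMem_of_add_mem hζ hcop hP (Ideal.Quotient.eq_zero_iff_mem.1 h)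
  have hpow : π hζ.toInteger ^ i = ψ (-x / y) := by
    have h1 : (x : 𝓞 K ⧸ P) + y * π hζ.toInteger ^ i = 0 := by
      simpa [π] using Ideal.Quotient.eq_zero_iff_mem.2 hP
    rw [map_div₀, map_neg, map_intCast, map_intCast, eq_div_iff hy]
    linear_combination h1
  obtain ⟨b, hb⟩ : ∃ b : ZMod q, ψ b = π hζ.toInteger := by
    refine ⟨(-x / y) ^ ((i : ZMod p)⁻¹).val, ?_⟩
    rw [map_pow, ← hpow, ← map_pow, ← map_pow, ← pow_mul]
    refine congr_arg π ?_
    rw [toInteger_pow_eq hζ (a := i * ((i : ZMod p)⁻¹).val) (b := 1) (by simp [hi]), pow_one]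
  have hsurj : Function.Surjective ψ := by
    intro w
    obtain ⟨w, rfl⟩ := Ideal.Quotient.mk_surjective w
    obtain ⟨f, rfl⟩ := hζ.integralPowerBasis.exists_eq_aeval' w
    refine ⟨aeval b f, ?_⟩
    rw [hζ.integralPowerBasis_gen, aeval_def, aeval_def, hom_eval₂, hom_eval₂, hb]
    congr 1
    exact RingHom.ext_int _ _
  let e : ZMod q ≃+* 𝓞 K ⧸ P := RingEquiv.ofBijective ψ ⟨ψ.injective, hsurj⟩
  refine ⟨q, hq, (e.symm : 𝓞 K ⧸ P →+* ZMod q).comp π, fun h => ?_, ?_⟩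
  · refine natCast_notMem_of_add_mem hζ hP hxy ?_
    rw [← Ideal.Quotient.eq_zero_iff_mem, map_natCast, ← h]
    exact CharP.cast_eq_zero _ _
  · ext w
    rw [RingHom.mem_ker, RingHom.comp_apply, RingHom.coe_coe, map_eq_zero_iff _ e.symm.injective]
    exact Ideal.Quotient.eq_zero_iff_mem

end PrimeFactors

omit [NumberField K] [IsCyclotomicExtension {p} ℚ K] in
theorem isCoprime_span_add {x y : ℤ} (hcop : IsCoprime x y)
    (hxy : ¬ (p : ℤ) ∣ x + y) {a b : ZMod p} (hab : a ≠ b) :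
    IsCoprime (Ideal.span {(x : 𝓞 K) + y * hζ.toInteger ^ a.val})
      (Ideal.span {(x : 𝓞 K) + y * hζ.toInteger ^ b.val}) := by
  rw [Ideal.isCoprime_iff_sup_eq]
  by_contra hne
  obtain ⟨P, hP, hle⟩ := Ideal.exists_le_maximal _ hne
  have := hP.isPrime
  have ha : (x : 𝓞 K) + y * hζ.toInteger ^ a.val ∈ P :=
    hle (Ideal.mem_sup_left (Ideal.mem_span_singleton_self _))
  have hb : (x : 𝓞 K) + y * hζ.toInteger ^ b.val ∈ P :=
    hle (Ideal.mem_sup_right (Ideal.mem_span_singleton_self _))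
  have hy := intCast_notMem_of_add_mem hζ hcop ha
  have hp0 := natCast_notMem_of_add_mem hζ ha hxy
  have hprim := isPrimitiveRoot_map_toInteger hζ (Ideal.Quotient.mk P) (by
    rw [← map_natCast (Ideal.Quotient.mk P)]
    exact fun h => hp0 (Ideal.Quotient.eq_zero_iff_mem.1 h))
  have hsub : (y : 𝓞 K) * (hζ.toInteger ^ a.val - hζ.toInteger ^ b.val) ∈ P := by
    have := P.sub_mem ha hb
    convert this using 1
    ring
  have hsub' := (this.mem_or_mem hsub).resolve_left hy
  rw [← Ideal.Quotient.eq, map_pow, map_pow] at hsub'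
  exact hab (ZMod.val_injective p (hprim.pow_inj (ZMod.val_lt _) (ZMod.val_lt _) hsub'))

theorem not_dvd_add_of_isFirstCaseSolution {x y z : ℤ} (h : IsFirstCaseSolution p x y z) :
    ¬ (p : ℤ) ∣ x + y := by
  intro hd
  have h1 : ((x + y : ℤ) : ZMod p) = 0 := (ZMod.intCast_zmod_eq_zero_iff_dvd _ p).2 hd
  have h2 := congr_arg (Int.cast : ℤ → ZMod p) h.1
  push_cast at h1 h2
  simp only [ZMod.pow_card] at h2
  refine h.2 (Dvd.dvd.mul_left ?_ _)
  rw [← ZMod.intCast_zmod_eq_zero_iff_dvd]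
  linear_combination h2 - h1

omit [IsCyclotomicExtension {p} ℚ K] in
/-- The ideals `(x + y ζ ^ a)` are pairwise coprime with product `(z) ^ p`. -/
theorem exists_ideal_pow_eq (hp : 2 < p) {x y z : ℤ} (h : IsFirstCaseSolution p x y z)
    (hcop : IsCoprime x y) :
    ∃ I : Ideal (𝓞 K), I ^ p = Ideal.span {(x : 𝓞 K) + y * hζ.toInteger} := by
  classical
  have hodd : Odd p := (Fact.out : p.Prime).odd_of_ne_two (by omega)
  have hprod : ∏ a : ZMod p, Ideal.span {(x : 𝓞 K) + y * hζ.toInteger ^ a.val} =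
      Ideal.span {(-z : 𝓞 K)} ^ p := by
    rw [Ideal.prod_span_singleton, prod_pow_toInteger_eq hζ hp, Ideal.span_singleton_pow,
      hodd.neg_pow]
    congr 2
    have := congr_arg (Int.cast : ℤ → 𝓞 K) h.1
    push_cast at this
    linear_combination this
  let : GCDMonoid (Ideal (𝓞 K)) := UniqueFactorizationMonoid.toGCDMonoid _
  obtain ⟨I, hI⟩ := Finset.exists_eq_pow_of_mul_eq_pow_of_coprime
    (fun a _ b _ hab => isCoprime_span_add hζ hcop
      (not_dvd_add_of_isFirstCaseSolution h) hab) hprod (1 : ZMod p) (Finset.mem_univ _)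
  have : Fact (1 < p) := ⟨by omega⟩
  rw [ZMod.val_one, pow_one] at hI
  exact ⟨I, hI.symm⟩

omit [IsCyclotomicExtension {p} ℚ K] in
theorem add_toInteger_ne_zero (hp : 2 < p) {x y z : ℤ} (h : IsFirstCaseSolution p x y z)
    (a : ZMod p) : (x : 𝓞 K) + y * hζ.toInteger ^ a.val ≠ 0 := by
  intro h0
  have h1 := prod_pow_toInteger_eq hζ hp (x : 𝓞 K) y
  rw [Finset.prod_eq_zero (Finset.mem_univ a) h0] at h1
  have h2 : x ^ p + y ^ p = 0 := by
    have : ((x ^ p + y ^ p : ℤ) : 𝓞 K) = 0 := by push_cast; exact h1.symm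
    exact_mod_cast this
  have h3 : z ^ p = 0 := by linear_combination h.1 - h2
  exact h.2 (by rw [eq_zero_of_pow_eq_zero h3, mul_zero]; exact dvd_zero _)

include hζ in
/-- Stickelberger's relation for an ideal composed of primes of degree one away from `p`. -/
theorem isPrincipal_prod_map_cycloAut {α β : ZMod p} (hα : α ≠ 0) (hβ : β ≠ 0)
    (hαβ : α + β ≠ 0) (I : Ideal (𝓞 K))
    (hI : ∀ P : Ideal (𝓞 K), P.IsPrime → I ≤ P →
      ∃ (q : ℕ) (_ : Fact q.Prime) (φ : 𝓞 K →+* ZMod q), q ≠ p ∧ RingHom.ker φ = P) :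
    (∏ j ∈ smallSumSet α β, I.map (cycloAut K j⁻¹)).IsPrincipal := by
  induction I using UniqueFactorizationMonoid.induction_on_prime with
  | h₁ =>
    rcases (smallSumSet α β).eq_empty_or_nonempty with h | ⟨j, hj⟩
    · rw [h, Finset.prod_empty, Ideal.one_eq_top]
      exact ⟨⟨1, by simp⟩⟩
    · rw [Finset.prod_eq_zero hj (by simp)]
      exact ⟨⟨0, by simp⟩⟩
  | h₂ J hJ =>
    rw [Ideal.isUnit_iff] at hJ
    subst hJ
    simp only [Ideal.map_top]
    rw [← Ideal.one_eq_top, Finset.prod_const_one, Ideal.one_eq_top]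
    exact ⟨⟨1, by simp⟩⟩
  | h₃ J P hJ hP ih =>
    obtain ⟨q, hq, φ, hqp, rfl⟩ := hI P (Ideal.isPrime_of_prime hP) Ideal.mul_le_left
    have h1 := isPrincipal_prod_map_cycloAut_ker hζ φ hqp hα hβ hαβ
    have h2 := ih fun P' hP' hle => hI P' hP' (Ideal.mul_le_right.trans hle)
    simp_rw [Ideal.map_mul]
    rw [Finset.prod_mul_distrib]
    obtain ⟨u, hu⟩ := h1.principal
    obtain ⟨v, hv⟩ := h2.principal
    rw [hu, hv]
    exact ⟨⟨u * v, Ideal.span_singleton_mul_span_singleton u v⟩⟩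

section Relations

variable {x y z : ℤ} (h : IsFirstCaseSolution p x y z) {I : Ideal (𝓞 K)}
  (hI : I ^ p = Ideal.span {(x : 𝓞 K) + y * hζ.toInteger})

include hI in
theorem map_cycloAut_pow_eq (a : (ZMod p)ˣ) : (I.map (cycloAut K a)) ^ p =
    Ideal.span {(x : 𝓞 K) + y * hζ.toInteger ^ (a : ZMod p).val} := by
  have hz : hζ.toInteger ^ p = 1 := hζ.toInteger_isPrimitiveRoot.pow_eq_one
  rw [← Ideal.map_pow, hI, Ideal.map_span, Set.image_singleton, map_add, map_mul, map_intCast,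
    map_intCast, cycloAut_of_pow_eq_one a hz]

include hI h in
/-- A relation in the class group between the conjugates of the ideal `I` with
`I ^ p = (x + y ζ)` yields a relation modulo `p`. -/
theorem mirimanoffValue_mul_sum_eq_zero_of_isPrincipal (hp : 2 < p) (n : (ZMod p)ˣ → ℕ)
    (hn : (∏ a, (I.map (cycloAut K a)) ^ n a).IsPrincipal) {m : ℕ} (hm : 1 ≤ m)
    (hm' : m ≤ (p - 3) / 2) :
    mirimanoffValue p (2 * m) (-(x : ZMod p) / y) *
      ∑ a : (ZMod p)ˣ, (n a : ZMod p) * (a : ZMod p) ^ (2 * m + 1) = 0 := by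
  obtain ⟨γ, hγ⟩ := hn.principal
  have h1 : Ideal.span {γ ^ p} = Ideal.span {∏ a : (ZMod p)ˣ,
      ((x : 𝓞 K) + y * hζ.toInteger ^ (a : ZMod p).val) ^ n a} := by
    rw [← Ideal.span_singleton_pow, ← Ideal.prod_span_singleton, Ideal.span, ← hγ,
      ← Finset.prod_pow]
    refine Finset.prod_congr rfl fun a _ => ?_
    rw [pow_right_comm, map_cycloAut_pow_eq hζ hI, Ideal.span_singleton_pow]
  obtain ⟨u, hu⟩ := Ideal.span_singleton_eq_span_singleton.1 h1
  refine mirimanoffValue_mul_sum_eq_zero_of_prod_eq hζ hp ?_ ?_ n u γ ?_ hm hm'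
  · intro hy
    exact h.2 (((ZMod.intCast_zmod_eq_zero_iff_dvd _ p).1 hy).mul_left _ |>.mul_right _)
  · intro hxy
    refine not_dvd_add_of_isFirstCaseSolution h ?_
    rw [← ZMod.intCast_zmod_eq_zero_iff_dvd]
    exact_mod_cast hxy
  · rw [← hu, mul_comm]

include hI h in
/-- Kummer's congruences in the form given by Stickelberger's relation. -/
theorem mirimanoffValue_mul_sum_smallSumSet_eq_zero (hp : 2 < p) (hcop : IsCoprime x y)
    {α β : ZMod p} (hα : α ≠ 0) (hβ : β ≠ 0) (hαβ : α + β ≠ 0) {m : ℕ} (hm : 1 ≤ m)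
    (hm' : m ≤ (p - 3) / 2) :
    mirimanoffValue p (2 * m) (-(x : ZMod p) / y) *
      ∑ j ∈ smallSumSet α β, ((j : ZMod p) ^ (2 * m + 1))⁻¹ = 0 := by
  classical
  have : Fact (1 < p) := ⟨by omega⟩
  have hpr := isPrincipal_prod_map_cycloAut hζ hα hβ hαβ I fun P hP hle => by
    have hmem : (x : 𝓞 K) + y * hζ.toInteger ^ 1 ∈ P := by
      rw [pow_one]
      refine hle (Ideal.pow_le_self (by omega : p ≠ 0) ?_)
      rw [hI]
      exact Ideal.mem_span_singleton_self _
    have hP0 : P ≠ ⊥ := by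
      rintro rfl
      have := add_toInteger_ne_zero hζ hp h 1
      rw [ZMod.val_one] at this
      exact this (by simpa using hmem)
    exact exists_ringHom_zmod_of_add_mem hζ hcop hmem (not_dvd_add_of_isFirstCaseSolution h) hP0
      (by simp)
  have key := mirimanoffValue_mul_sum_eq_zero_of_isPrincipal hζ h hI hp
    (fun a => if a⁻¹ ∈ smallSumSet α β then 1 else 0) (by
      convert hpr using 1
      rw [← Equiv.prod_comp (Equiv.inv (ZMod p)ˣ)]
      simp only [Equiv.inv_apply, inv_inv, pow_ite, pow_one, pow_zero]
      rw [Finset.prod_ite_mem, Finset.univ_inter]) hm hm'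
  rw [← key, ← Equiv.sum_comp (Equiv.inv (ZMod p)ˣ)]
  simp only [Equiv.inv_apply, inv_inv, Nat.cast_ite, Nat.cast_one, Nat.cast_zero, ite_mul, one_mul,
    zero_mul, Units.val_inv_eq_inv_val, inv_pow]
  rw [Finset.sum_ite_mem, Finset.univ_inter]

end Relations

/-- The exponent `(a⁻¹) ^ (2 m + 1)` makes the sums over `a` orthogonal. -/
theorem sum_units_pow_mul_inv_pow {m m' : ℕ} (hm : m ≤ (p - 3) / 2) (hm' : m' ≤ (p - 3) / 2)
    (hp : 2 < p) :
    ∑ a : (ZMod p)ˣ, ((a⁻¹ : (ZMod p)ˣ) : ZMod p) ^ (2 * m + 1) * (a : ZMod p) ^ (2 * m' + 1) =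
      if m = m' then -1 else 0 := by
  have h1 : ∀ a : (ZMod p)ˣ, ((a⁻¹ : (ZMod p)ˣ) : ZMod p) ^ (2 * m + 1) *
      (a : ZMod p) ^ (2 * m' + 1) = (a : ZMod p) ^ (p - 1 + 2 * m' - 2 * m) := by
    intro a
    rw [Units.val_inv_eq_inv_val, inv_pow, inv_mul_eq_iff_eq_mul₀ (pow_ne_zero _ a.ne_zero),
      ← pow_add, show 2 * m + 1 + (p - 1 + 2 * m' - 2 * m) = p - 1 + (2 * m' + 1) by omega,
      pow_add _ (p - 1), ZMod.pow_card_sub_one_eq_one a.ne_zero, one_mul]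
  simp_rw [h1]
  have h2 := FiniteField.sum_pow_units (ZMod p) (p - 1 + 2 * m' - 2 * m)
  rw [ZMod.card] at h2
  rw [h2]
  refine if_congr ⟨fun hd => ?_, fun hd => ?_⟩ rfl rfl
  · obtain ⟨c, hc⟩ := hd
    rcases c with _ | _ | c
    · omega
    · omega
    · have : (p - 1) * (c + 1 + 1) = (p - 1) * c + (p - 1) + (p - 1) := by ring
      omega
  · subst hd
    simp

open scoped nonZeroDivisors in
include hζ in
/-- The classes `∑ a ^ (-2 m - 1) [σ_a I]`, for `m` in the Mirimanoff support, are linearly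
independent in the `p`-torsion of the class group: a linear relation is a principal product of
conjugates of `I`, and the resulting congruence of order `2 m + 1` isolates the coefficient of the
class belonging to `m`. -/
theorem card_mirimanoffSupport_le_finrank (hp : 2 < p) {x y z : ℤ}
    (h : IsFirstCaseSolution p x y z) (hcop : IsCoprime x y) :
    letI : Module (ZMod p)
        (AddSubgroup.torsionBy (Additive (ClassGroup (𝓞 K))) (p : ℤ)) :=
      AddSubgroup.torsionBy.zmodModule
    (mirimanoffSupport p (-(x : ZMod p) / (y : ZMod p))).card ≤
      Module.finrank (ZMod p)
        (AddSubgroup.torsionBy (Additive (ClassGroup (𝓞 K))) (p : ℤ)) := by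
  classical
  obtain ⟨I, hI⟩ := exists_ideal_pow_eq hζ hp h hcop
  set t := -(x : ZMod p) / (y : ZMod p) with ht
  have ha0 : ∀ a : (ZMod p)ˣ, (I.map (cycloAut K a)) ∈ (Ideal (𝓞 K))⁰ := fun a => by
    rw [mem_nonZeroDivisors_iff_ne_zero]
    intro h0
    have h1 := map_cycloAut_pow_eq hζ hI a
    rw [h0, zero_pow (by omega), Ideal.zero_eq_bot, eq_comm, Ideal.span_singleton_eq_bot] at h1
    exact add_toInteger_ne_zero hζ hp h _ h1
  let A : (ZMod p)ˣ → (Ideal (𝓞 K))⁰ := fun a => ⟨_, ha0 a⟩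
  let c : (ZMod p)ˣ → ClassGroup (𝓞 K) := fun a => ClassGroup.mk0 (A a)
  have hc : ∀ a, c a ^ p = 1 := fun a => by
    have : A a ^ p = ⟨_, (A a ^ p).2⟩ := rfl
    rw [← map_pow, this, ClassGroup.mk0_eq_one_iff]
    change ((I.map (cycloAut K a)) ^ p).IsPrincipal
    rw [map_cycloAut_pow_eq hζ hI]
    exact ⟨⟨_, rfl⟩⟩
  let T := AddSubgroup.torsionBy (Additive (ClassGroup (𝓞 K))) (p : ℤ)
  let : Module (ZMod p) T := AddSubgroup.torsionBy.zmodModule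
  let w : ℕ → ClassGroup (𝓞 K) := fun m =>
    ∏ a : (ZMod p)ˣ, c a ^ (((a⁻¹ : (ZMod p)ˣ) : ZMod p) ^ (2 * m + 1)).val
  have hw : ∀ m, Additive.ofMul (w m) ∈ T := fun m => by
    rw [AddSubgroup.torsionBy.nsmul_iff, ← ofMul_pow, ofMul_eq_zero, ← Finset.prod_pow]
    refine Finset.prod_eq_one fun a _ => ?_
    rw [pow_right_comm, hc, one_pow]
  let v : mirimanoffSupport p t → T := fun m => ⟨_, hw m⟩
  have hfin : Module.Finite (ZMod p) T := Module.Finite.of_finite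
  have hv : LinearIndependent (ZMod p) v := by
    rw [Fintype.linearIndependent_iff]
    intro g hg m'
    obtain ⟨⟨hm1, hm2⟩, hm3⟩ := mem_mirimanoffSupport.1 m'.2
    have hprod : ∏ m : mirimanoffSupport p t, w m ^ (g m).val = 1 := by
      have h1 : ∑ m, (g m).val • v m = 0 := by
        rw [← hg]
        refine Finset.sum_congr rfl fun m _ => ?_
        rw [← Nat.cast_smul_eq_nsmul (ZMod p), ZMod.natCast_zmod_val]
      have h2 := congr_arg (fun u : T => Additive.toMul (u : Additive (ClassGroup (𝓞 K)))) h1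
      simpa [v] using h2
    let n : (ZMod p)ˣ → ℕ := fun a => ∑ m : mirimanoffSupport p t,
      (((a⁻¹ : (ZMod p)ˣ) : ZMod p) ^ (2 * (m : ℕ) + 1)).val * (g m).val
    have hn : ∏ a, c a ^ n a = 1 := by
      rw [← hprod]
      simp only [w, n, ← Finset.prod_pow, ← Finset.prod_pow_eq_pow_sum, ← pow_mul]
      exact Finset.prod_comm
    have hpr : (∏ a, (I.map (cycloAut K a)) ^ n a).IsPrincipal := by
      have h1 : ∏ a, A a ^ n a = ⟨_, (∏ a, A a ^ n a).2⟩ := rfl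
      have h2 : ClassGroup.mk0 (∏ a, A a ^ n a) = 1 := by
        rw [map_prod, ← hn]
        simp only [map_pow, c]
      rw [h1, ClassGroup.mk0_eq_one_iff] at h2
      simpa [A] using h2
    have key := mirimanoffValue_mul_sum_eq_zero_of_isPrincipal hζ h hI hp n hpr hm1 hm2
    have hsum := (mul_eq_zero.1 key).resolve_left hm3
    have hval : ∑ a : (ZMod p)ˣ, (n a : ZMod p) * (a : ZMod p) ^ (2 * (m' : ℕ) + 1) = - g m' := by
      have : ∀ m : mirimanoffSupport p t, g m * ∑ a : (ZMod p)ˣ,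
          ((a⁻¹ : (ZMod p)ˣ) : ZMod p) ^ (2 * (m : ℕ) + 1) * (a : ZMod p) ^ (2 * (m' : ℕ) + 1) =
          if m = m' then - g m' else 0 := by
        intro m
        rw [sum_units_pow_mul_inv_pow (mem_mirimanoffSupport.1 m.2).1.2 hm2 hp]
        by_cases hmm : m = m'
        · simp [hmm]
        · simp [hmm, Subtype.coe_injective.ne hmm]
      calc ∑ a : (ZMod p)ˣ, (n a : ZMod p) * (a : ZMod p) ^ (2 * (m' : ℕ) + 1)
          = ∑ a : (ZMod p)ˣ, ∑ m : mirimanoffSupport p t,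
              ((a⁻¹ : (ZMod p)ˣ) : ZMod p) ^ (2 * (m : ℕ) + 1) * g m *
                (a : ZMod p) ^ (2 * (m' : ℕ) + 1) := by
            simp only [n, Nat.cast_sum, Nat.cast_mul, ZMod.natCast_zmod_val, Finset.sum_mul]
        _ = ∑ m : mirimanoffSupport p t, g m * ∑ a : (ZMod p)ˣ,
              ((a⁻¹ : (ZMod p)ˣ) : ZMod p) ^ (2 * (m : ℕ) + 1) *
                (a : ZMod p) ^ (2 * (m' : ℕ) + 1) := by
            rw [Finset.sum_comm]
            refine Finset.sum_congr rfl fun m _ => ?_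
            rw [Finset.mul_sum]
            exact Finset.sum_congr rfl fun a _ => by ring
        _ = ∑ m : mirimanoffSupport p t, if m = m' then - g m' else 0 :=
            Finset.sum_congr rfl fun m _ => this m
        _ = - g m' := by simp
    rw [hval, neg_eq_zero] at hsum
    exact hsum
  have := hv.fintype_card_le_finrank
  rw [Fintype.card_coe] at this
  exact this

end Descent

theorem card_mirimanoffSupport_le_rank {p : ℕ} [Fact p.Prime] (hp : 2 < p) {x y z : ℤ}
    (h : IsFirstCaseSolution p x y z) (hcop : IsCoprime x y) :
    (mirimanoffSupport p (-(x : ZMod p) / (y : ZMod p))).card ≤ cyclotomicClassGroupRank p := by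
  have : NeZero ((p : ℕ) : ℚ) := ⟨Nat.cast_ne_zero.2 (Fact.out : p.Prime).ne_zero⟩
  have : IsCyclotomicExtension {p} ℚ (CyclotomicField p ℚ) :=
    CyclotomicField.isCyclotomicExtension p ℚ
  exact card_mirimanoffSupport_le_finrank
    (IsCyclotomicExtension.zeta_spec p ℚ (CyclotomicField p ℚ)) hp h hcop

/-! ### Sums over blocks -/

section Blocks

variable {p : ℕ}

/-- The union of the blocks `[l p / (d + 1), l p / d[` for `1 ≤ l ≤ d`. -/
def blockUnion (p d : ℕ) : Set ℝ := ⋃ l ∈ Set.Icc 1 d, block p d l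

theorem natCast_mem_block {d l j : ℕ} (hd : 1 ≤ d) :
    (j : ℝ) ∈ block p d l ↔ l * p ≤ (d + 1) * j ∧ d * j < l * p := by
  have h1 : (0 : ℝ) < d + 1 := by positivity
  have h2 : (0 : ℝ) < d := by exact_mod_cast hd
  rw [block, Set.mem_Ico, div_le_iff₀ h1, lt_div_iff₀ h2]
  norm_cast
  rw [mul_comm j, mul_comm j]

/-- Writing `d j = p f + r`, the only possible `l` is `f + 1`, and it occurs iff `r + j ≥ p`. -/
theorem natCast_mem_blockUnion {d j : ℕ} (hd : 1 ≤ d) (hj : j < p) :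
    (j : ℝ) ∈ blockUnion p d ↔ p ≤ j + d * j % p := by
  have hdiv := Nat.div_add_mod (d * j) p
  have hmod := Nat.mod_lt (d * j) (by omega : 0 < p)
  generalize d * j / p = f at *
  generalize d * j % p = r at *
  simp only [blockUnion, Set.mem_iUnion, natCast_mem_block hd, Set.mem_Icc, exists_prop]
  constructor
  · rintro ⟨l, -, h1, h2⟩
    have h3 : f + 1 ≤ l := by
      by_contra! h
      have := Nat.mul_le_mul_right p (Nat.lt_succ_iff.1 h)
      rw [mul_comm f p] at this
      omega
    have := Nat.mul_le_mul_right p h3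
    rw [add_mul, mul_comm f p] at this
    rw [add_mul] at h1
    omega
  · intro h
    refine ⟨f + 1, ⟨by omega, ?_⟩, ?_, ?_⟩
    · have h1 : p * f < p * d := by
        calc p * f ≤ d * j := by omega
          _ < d * p := Nat.mul_lt_mul_of_pos_left hj hd
          _ = p * d := mul_comm _ _
      exact Nat.lt_of_mul_lt_mul_left h1
    · rw [add_mul, add_mul, mul_comm f p]
      omega
    · rw [add_mul, mul_comm f p]
      omega

theorem disjoint_block {d l l' : ℕ} (hl : l ∈ Finset.Icc 1 d) (hl' : l' ∈ Finset.Icc 1 d)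
    (h : l ≠ l') : Disjoint (block p d l) (block p d l') := by
  wlog hlt : l < l' generalizing l l'
  · exact (this hl' hl h.symm (by omega)).symm
  rw [Finset.mem_Icc] at hl hl'
  rw [Set.disjoint_left]
  intro u hu hu'
  have h1 : (0 : ℝ) < d + 1 := by positivity
  have h2 : (0 : ℝ) < d := by exact_mod_cast (by omega : 0 < d)
  have h3 : (l : ℝ) * p / d ≤ l' * p / (d + 1) := by
    rw [div_le_div_iff₀ h2 h1]
    have : l * p * (d + 1) ≤ l' * p * d := by
      have : l * (d + 1) ≤ l' * d := by nlinarith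
      calc l * p * (d + 1) = l * (d + 1) * p := by ring
        _ ≤ l' * d * p := Nat.mul_le_mul_right _ this
        _ = l' * p * d := by ring
    exact_mod_cast this
  exact absurd (hu.2.trans_le h3) (not_lt.2 hu'.1)

theorem recipSum_biUnion {ι : Type*} (μ : ℕ) (s : Finset ι) (A : ι → Set ℝ)
    (h : (s : Set ι).PairwiseDisjoint A) :
    recipSum p μ (⋃ i ∈ s, A i) = ∑ i ∈ s, recipSum p μ (A i) := by
  classical
  induction s using Finset.induction_on with
  | empty => simp [recipSum]
  | insert i s hi ih =>
    rw [Finset.sum_insert hi, ← ih (h.subset (by simp)), Finset.set_biUnion_insert]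
    simp only [recipSum]
    rw [← Finset.sum_union]
    · rw [← Finset.filter_or]
      simp only [Set.mem_union]
    · rw [Finset.disjoint_filter]
      intro j _ h1 h2
      simp only [Set.mem_iUnion] at h2
      obtain ⟨k, hk, h2⟩ := h2
      exact Set.disjoint_left.1 (h (by simp) (by simp [hk]) (ne_of_mem_of_not_mem hk hi).symm) h1 h2

theorem sum_recipSum_inter_eq (μ d₁ d₂ : ℕ) :
    (∑ l ∈ Finset.Icc 1 d₁, ∑ m ∈ Finset.Icc 1 d₂, recipSum p μ (block p d₁ l ∩ block p d₂ m)) =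
      recipSum p μ (⋃ l ∈ Set.Icc 1 d₁, ⋃ m ∈ Set.Icc 1 d₂, block p d₁ l ∩ block p d₂ m) := by
  simp only [← Finset.coe_Icc, Finset.mem_coe]
  rw [recipSum_biUnion]
  · refine Finset.sum_congr rfl fun l _ => (recipSum_biUnion μ _ _ fun m hm m' hm' hne => ?_).symm
    exact (disjoint_block hm hm' hne).mono Set.inter_subset_right Set.inter_subset_right
  · intro l hl l' hl' hne
    refine (disjoint_block (p := p) hl hl' hne).mono ?_ ?_ <;>
    exact Set.iUnion₂_subset fun _ _ => Set.inter_subset_left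

theorem iUnion_block_inter (d₁ d₂ : ℕ) :
    (⋃ l ∈ Set.Icc 1 d₁, ⋃ m ∈ Set.Icc 1 d₂, block p d₁ l ∩ block p d₂ m) =
      blockUnion p d₁ ∩ blockUnion p d₂ := by
  simp_rw [blockUnion, Set.iUnion₂_inter, Set.inter_iUnion₂]

variable [Fact p.Prime]

open Classical in
theorem recipSum_eq_sum_units (μ : ℕ) (A : Set ℝ) :
    recipSum p μ A = ∑ u : (ZMod p)ˣ,
      (if ((u : ZMod p).val : ℝ) ∈ A then 1 else 0) * ((u : ZMod p) ^ μ)⁻¹ := by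
  simp only [ite_mul, one_mul, zero_mul]
  rw [recipSum, ← Finset.sum_filter]
  symm
  refine Finset.sum_nbij (fun u => (u : ZMod p).val) (fun u hu => ?_) (fun u _ v _ huv => ?_)
    (fun j hj => ?_) fun u _ => ?_
  · rw [Finset.mem_filter] at hu ⊢
    have h1 := (ZMod.val_ne_zero (u : ZMod p)).2 u.ne_zero
    have h2 := ZMod.val_lt (u : ZMod p)
    exact ⟨Finset.mem_Icc.2 ⟨by omega, by omega⟩, hu.2⟩
  · exact Units.ext (ZMod.val_injective p huv)
  · rw [Finset.mem_coe, Finset.mem_filter, Finset.mem_Icc] at hj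
    have hj0 : (j : ZMod p) ≠ 0 := by
      rw [Ne, ZMod.natCast_eq_zero_iff]
      exact Nat.not_dvd_of_pos_of_lt (by omega) (by omega)
    have hval : (j : ZMod p).val = j := ZMod.val_cast_of_lt (by omega)
    refine ⟨Units.mk0 _ hj0, Finset.mem_coe.2 (Finset.mem_filter.2 ⟨Finset.mem_univ _, ?_⟩), hval⟩
    rw [Units.val_mk0, hval]
    exact hj.2
  · rw [ZMod.natCast_zmod_val]

theorem mem_blockUnion_iff {d : ℕ} (hd : 1 ≤ d) (u : (ZMod p)ˣ) :
    ((u : ZMod p).val : ℝ) ∈ blockUnion p d ↔ u ∉ smallSumSet (1 : ZMod p) (d : ZMod p) := by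
  have h : ((u : ZMod p) * d).val = d * (u : ZMod p).val % p := by
    rw [← ZMod.val_natCast, Nat.cast_mul, ZMod.natCast_zmod_val, mul_comm]
  rw [natCast_mem_blockUnion hd (ZMod.val_lt _)]
  simp [smallSumSet, h]

theorem natCast_zmod_ne_zero_of_lt {d : ℕ} (hd : 1 ≤ d) (hd' : d < p) : (d : ZMod p) ≠ 0 := by
  rw [Ne, ZMod.natCast_eq_zero_iff]
  exact Nat.not_dvd_of_pos_of_lt hd hd'

theorem one_add_natCast_zmod_ne_zero {d : ℕ} (hd' : d + 1 < p) : (1 : ZMod p) + d ≠ 0 := by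
  have := natCast_zmod_ne_zero_of_lt (p := p) (d := 1 + d) (by omega) (by omega)
  simpa using this

theorem neg_mem_blockUnion_iff {d : ℕ} (hd : 1 ≤ d) (hd' : d + 1 < p) (u : (ZMod p)ˣ) :
    (((-u : (ZMod p)ˣ) : ZMod p).val : ℝ) ∈ blockUnion p d ↔
      ((u : ZMod p).val : ℝ) ∉ blockUnion p d := by
  rw [mem_blockUnion_iff hd, mem_blockUnion_iff hd, neg_mem_smallSumSet one_ne_zero
    (natCast_zmod_ne_zero_of_lt hd (by omega)) (one_add_natCast_zmod_ne_zero hd')]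

theorem recipSum_blockUnion {d : ℕ} (hd : 1 ≤ d) (hd' : d + 1 < p) (μ : ℕ) :
    recipSum p μ (blockUnion p d) =
      ∑ j ∈ smallSumSet (-1 : ZMod p) (-d : ZMod p), ((j : ZMod p) ^ μ)⁻¹ := by
  classical
  rw [recipSum_eq_sum_units]
  simp only [ite_mul, one_mul, zero_mul]
  rw [← Finset.sum_filter]
  refine Finset.sum_congr ?_ fun _ _ => rfl
  ext j
  rw [Finset.mem_filter, mem_blockUnion_iff hd, ← neg_mem_smallSumSet one_ne_zero
    (natCast_zmod_ne_zero_of_lt hd (by omega)) (one_add_natCast_zmod_ne_zero hd')]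
  simp [smallSumSet]

theorem sum_units_eq_neg {μ : ℕ} (hμ : Odd μ) (f : (ZMod p)ˣ → ZMod p) :
    ∑ u : (ZMod p)ˣ, f (-u) * ((u : ZMod p) ^ μ)⁻¹ =
      -∑ u : (ZMod p)ˣ, f u * ((u : ZMod p) ^ μ)⁻¹ := by
  rw [← Equiv.sum_comp (Equiv.neg (ZMod p)ˣ), ← Finset.sum_neg_distrib]
  refine Finset.sum_congr rfl fun u _ => ?_
  simp only [Equiv.neg_apply, neg_neg, Units.val_neg, hμ.neg_pow, inv_neg, mul_neg]

theorem two_zmod_ne_zero (hp : 2 < p) : (2 : ZMod p) ≠ 0 := by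
  exact_mod_cast natCast_zmod_ne_zero_of_lt (p := p) (d := 2) (by omega) hp

theorem sum_units_inv_pow_eq_zero (hp : 2 < p) {μ : ℕ} (hμ : Odd μ) :
    ∑ u : (ZMod p)ˣ, ((u : ZMod p) ^ μ)⁻¹ = 0 := by
  have h := sum_units_eq_neg (p := p) hμ fun _ => 1
  simp only [one_mul] at h
  exact (mul_eq_zero.1 (by linear_combination h :
    (2 : ZMod p) * ∑ u : (ZMod p)ˣ, ((u : ZMod p) ^ μ)⁻¹ = 0)).resolve_left (two_zmod_ne_zero hp)

/-- If `χ` denotes the indicator function of a union of blocks, then `χ (-u) = 1 - χ u`, so the odd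
part of a product `χ₁ χ₂` is that of `(χ₁ + χ₂) / 2`. -/
theorem two_mul_recipSum_inter (hp : 2 < p) {μ d₁ d₂ : ℕ} (hμ : Odd μ) (h₁ : 1 ≤ d₁)
    (h₁' : d₁ + 1 < p) (h₂ : 1 ≤ d₂) (h₂' : d₂ + 1 < p) :
    2 * recipSum p μ (blockUnion p d₁ ∩ blockUnion p d₂) =
      recipSum p μ (blockUnion p d₁) + recipSum p μ (blockUnion p d₂) := by
  classical
  let χ (A : Set ℝ) (u : (ZMod p)ˣ) : ZMod p := if ((u : ZMod p).val : ℝ) ∈ A then 1 else 0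
  have hS : ∀ A, recipSum p μ A = ∑ u, χ A u * ((u : ZMod p) ^ μ)⁻¹ := recipSum_eq_sum_units μ
  have hneg : ∀ u, χ (blockUnion p d₁ ∩ blockUnion p d₂) (-u) =
      1 - χ (blockUnion p d₁) u - χ (blockUnion p d₂) u +
        χ (blockUnion p d₁ ∩ blockUnion p d₂) u := by
    intro u
    simp only [χ, Set.mem_inter_iff, neg_mem_blockUnion_iff h₁ h₁', neg_mem_blockUnion_iff h₂ h₂']
    by_cases a : ((u : ZMod p).val : ℝ) ∈ blockUnion p d₁ <;>
    by_cases b : ((u : ZMod p).val : ℝ) ∈ blockUnion p d₂ <;> simp [a, b, -ZMod.natCast_val]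
  have key := sum_units_eq_neg hμ (χ (blockUnion p d₁ ∩ blockUnion p d₂))
  simp only [hneg, add_mul, sub_mul, one_mul, Finset.sum_add_distrib, Finset.sum_sub_distrib,
    sum_units_inv_pow_eq_zero hp hμ, ← hS] at key
  linear_combination key

theorem recipSum_blockUnion_one (hp : 2 < p) {μ : ℕ} (hμ : Odd μ) :
    recipSum p μ (blockUnion p 1) =
      -∑ j ∈ Finset.Icc 1 ((p - 1) / 2), ((j : ZMod p) ^ μ)⁻¹ := by
  classical
  have hodd := (Fact.out : p.Prime).odd_of_ne_two (by omega)
  have h0 : recipSum p μ Set.univ = 0 := by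
    rw [recipSum_eq_sum_units]
    simpa using sum_units_inv_pow_eq_zero hp hμ
  have h1 : (Finset.Icc 1 (p - 1)).filter (fun j : ℕ => ¬ (j : ℝ) ∈ blockUnion p 1) =
      Finset.Icc 1 ((p - 1) / 2) := by
    ext j
    rw [Finset.mem_filter, Finset.mem_Icc, Finset.mem_Icc]
    constructor
    · rintro ⟨⟨h1, h2⟩, h3⟩
      rw [natCast_mem_blockUnion le_rfl (by omega), one_mul, Nat.mod_eq_of_lt (by omega)] at h3
      omega
    · rintro ⟨h1, h2⟩
      rw [natCast_mem_blockUnion le_rfl (by omega), one_mul, Nat.mod_eq_of_lt (by omega)]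
      omega
  rw [eq_neg_iff_add_eq_zero, ← h0, ← h1, recipSum, recipSum, Finset.sum_filter_add_sum_filter_not]
  simp

end Blocks

/-! ### Consequences for the first case -/

section FirstCase

variable {p : ℕ} [Fact p.Prime]

/-- Dividing by the common factor of `x` and `y` changes neither `x / y` nor the hypotheses. -/
theorem IsFirstCaseSolution.exists_isCoprime {x y z : ℤ} (h : IsFirstCaseSolution p x y z) :
    ∃ x' y' z' : ℤ, IsFirstCaseSolution p x' y' z' ∧ IsCoprime x' y' ∧
      -(x' : ZMod p) / (y' : ZMod p) = -(x : ZMod p) / (y : ZMod p) := by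
  have hp0 : p ≠ 0 := (Fact.out : p.Prime).ne_zero
  have hx0 : x ≠ 0 := by
    rintro rfl
    exact h.2 (by simp)
  obtain ⟨g, x', y', hg, hcop, hx, hy⟩ := Int.exists_gcd_one' (m := x) (n := y)
    (Int.gcd_pos_of_ne_zero_left y hx0)
  have hz : (g : ℤ) ∣ z := by
    rw [← Int.pow_dvd_pow_iff hp0]
    refine ⟨-(x' ^ p + y' ^ p), ?_⟩
    have := h.1
    rw [hx, hy, mul_pow, mul_pow] at this
    linear_combination this
  obtain ⟨z', rfl⟩ := hz
  have hg0 : (g : ℤ) ^ p ≠ 0 := pow_ne_zero _ (by exact_mod_cast hg.ne')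
  subst hx hy
  have hgp : ((g : ℤ) : ZMod p) ≠ 0 := by
    intro h0
    refine h.2 (((ZMod.intCast_zmod_eq_zero_iff_dvd _ p).1 h0).trans ?_)
    exact ⟨x' * (y' * g) * (g * z'), by ring⟩
  refine ⟨x', y', z', ⟨mul_left_cancel₀ hg0 ?_, fun hd => h.2 (hd.trans ?_)⟩,
    Int.isCoprime_iff_gcd_eq_one.2 hcop, ?_⟩
  · have := h.1
    rw [mul_zero]
    linear_combination this
  · exact ⟨g ^ 3, by ring⟩
  · push_cast at hgp ⊢
    rw [← neg_mul, mul_div_mul_right _ _ hgp]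

omit [Fact p.Prime] in
theorem IsFirstCaseSolution.rotate {x y z : ℤ} (h : IsFirstCaseSolution p x y z) :
    IsFirstCaseSolution p y z x :=
  ⟨by linear_combination h.1, by rw [mul_comm, ← mul_assoc]; exact h.2⟩

theorem IsFirstCaseSolution.cast_ne_zero {x y z : ℤ} (h : IsFirstCaseSolution p x y z) :
    (x : ZMod p) ≠ 0 := by
  rw [Ne, ZMod.intCast_zmod_eq_zero_iff_dvd]
  exact fun hd => h.2 ((hd.mul_right _).mul_right _)

theorem IsFirstCaseSolution.cast_add_eq_zero {x y z : ℤ} (h : IsFirstCaseSolution p x y z) :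
    (x : ZMod p) + y + z = 0 := by
  have := congr_arg (Int.cast : ℤ → ZMod p) h.1
  push_cast at this
  simpa only [ZMod.pow_card] using this

theorem IsFirstCaseSolution.recipSum_eq_zero (hp : 2 < p) {x y z : ℤ}
    (h : IsFirstCaseSolution p x y z) {m : ℕ}
    (hm : m ∈ mirimanoffSupport p (-(x : ZMod p) / (y : ZMod p))) {d : ℕ} (hd : 1 ≤ d)
    (hd' : d + 1 < p) : recipSum p (2 * m + 1) (blockUnion p d) = 0 := by
  obtain ⟨x', y', z', h', hcop, ht⟩ := h.exists_isCoprime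
  rw [← ht] at hm
  obtain ⟨⟨hm1, hm2⟩, hm3⟩ := mem_mirimanoffSupport.1 hm
  have : NeZero ((p : ℕ) : ℚ) := ⟨Nat.cast_ne_zero.2 (Fact.out : p.Prime).ne_zero⟩
  have : IsCyclotomicExtension {p} ℚ (CyclotomicField p ℚ) :=
    CyclotomicField.isCyclotomicExtension p ℚ
  have hζ := IsCyclotomicExtension.zeta_spec p ℚ (CyclotomicField p ℚ)
  obtain ⟨I, hI⟩ := exists_ideal_pow_eq hζ hp h' hcop
  have hsum : (-1 : ZMod p) + -d ≠ 0 := by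
    rw [← neg_add]
    exact neg_ne_zero.2 (one_add_natCast_zmod_ne_zero hd')
  rw [recipSum_blockUnion hd hd']
  exact (mul_eq_zero.1 (mirimanoffValue_mul_sum_smallSumSet_eq_zero hζ h' hI hp hcop
    (neg_ne_zero.2 one_ne_zero) (neg_ne_zero.2 (natCast_zmod_ne_zero_of_lt hd (by omega)))
    hsum hm1 hm2)).resolve_left hm3

theorem IsFirstCaseSolution.ratio_ne {x y z : ℤ} (h : IsFirstCaseSolution p x y z)
    (hxy : (x : ZMod p) ≠ y) : -(x : ZMod p) / y ≠ 0 ∧ -(x : ZMod p) / y ≠ 1 ∧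
      -(x : ZMod p) / y ≠ -1 := by
  have hx := h.cast_ne_zero
  have hy := h.rotate.cast_ne_zero
  have hz := h.rotate.rotate.cast_ne_zero
  refine ⟨div_ne_zero (neg_ne_zero.2 hx) hy, fun h1 => ?_, fun h1 => ?_⟩
  · rw [div_eq_one_iff_eq hy] at h1
    exact hz (by linear_combination h.cast_add_eq_zero + h1)
  · rw [div_eq_iff hy] at h1
    exact hxy (by linear_combination -h1)

theorem IsFirstCaseSolution.sum_inv_cube_eq_zero_of_ne (hp : 5 < p) {x y z : ℤ}
    (h : IsFirstCaseSolution p x y z) (hxy : (x : ZMod p) ≠ y) :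
    ∑ j ∈ Finset.Icc 1 ((p - 1) / 2), ((j : ZMod p) ^ 3)⁻¹ = 0 := by
  obtain ⟨h0, h1, h2⟩ := h.ratio_ne hxy
  have := h.recipSum_eq_zero (by omega) (one_mem_mirimanoffSupport hp h0 h1 h2) (d := 1) le_rfl
    (by omega)
  rwa [recipSum_blockUnion_one (by omega) (by decide), neg_eq_zero] at this

/-- Cauchy's criterion. As `x + y + z = 0` modulo `p`, the residues of `x, y, z` are not all
equal. -/
theorem IsFirstCaseSolution.sum_inv_cube_eq_zero (hp : 5 < p) {x y z : ℤ}
    (h : IsFirstCaseSolution p x y z) :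
    ∑ j ∈ Finset.Icc 1 ((p - 1) / 2), ((j : ZMod p) ^ 3)⁻¹ = 0 := by
  by_cases hxy : (x : ZMod p) = y
  · by_cases hyz : (y : ZMod p) = z
    · have h3 : (3 : ZMod p) ≠ 0 := by
        exact_mod_cast natCast_zmod_ne_zero_of_lt (p := p) (d := 3) (by omega) (by omega)
      refine absurd ?_ (mul_ne_zero h3 h.cast_ne_zero)
      linear_combination h.cast_add_eq_zero + hxy + (hxy + hyz)
    · exact h.rotate.sum_inv_cube_eq_zero_of_ne hp hyz
  · exact h.sum_inv_cube_eq_zero_of_ne hp hxy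

theorem IsFirstCaseSolution.notMem_exceptional (hp : 5 < p) {x y z : ℤ}
    (h : IsFirstCaseSolution p x y z) :
    p ∉ ({7, 11, 23, 43, 113, 223, 823, 1609} : Finset ℕ) :=
  fun hmem => sum_inv_cube_ne_zero hmem (h.sum_inv_cube_eq_zero hp)

theorem IsFirstCaseSolution.ten_lt (hp : 5 < p) {x y z : ℤ} (h : IsFirstCaseSolution p x y z) :
    10 < p := by
  have h7 := h.notMem_exceptional hp
  have hP : p.Prime := Fact.out
  by_contra! hle
  interval_cases p <;> first | exact h7 (by decide) | exact absurd hP (by norm_num)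

theorem IsFirstCaseSolution.subset_mirimanoffSupport (hp : 10 < p) {x y z : ℤ}
    (h : IsFirstCaseSolution p x y z) {w : ZMod p} (hw : w = (z : ZMod p) ^ 2 / (x * y))
    (h4 : w ≠ 4) (h12 : w ≠ 12) (hq : w ^ 2 - 60 * w + 360 ≠ 0) :
    (x : ZMod p) ≠ y ∧ {1, 2, 3} ⊆ mirimanoffSupport p (-(x : ZMod p) / y) := by
  have hx := h.cast_ne_zero
  have hy := h.rotate.cast_ne_zero
  have hwz : w * (x * y) = ((x : ZMod p) + y) ^ 2 := by
    rw [hw, div_mul_cancel₀ _ (mul_ne_zero hx hy)]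
    linear_combination -(x + y - z : ZMod p) * h.cast_add_eq_zero
  have hxy : (x : ZMod p) ≠ y := fun e =>
    h4 (mul_right_cancel₀ (mul_ne_zero hx hy) (by linear_combination hwz + (x - y : ZMod p) * e))
  obtain ⟨t0, t1, t2⟩ := h.ratio_ne hxy
  set t : ZMod p := -(x : ZMod p) / y with ht
  have hty : t * y = -x := by rw [ht, div_mul_cancel₀ _ hy]
  have hwt : -w * t = (1 - t) ^ 2 := by
    refine mul_right_cancel₀ (pow_ne_zero 2 hy) ?_
    linear_combination hwz + (x + 2 * y - t * y - w * y) * hty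
  refine ⟨hxy, ?_⟩
  simp only [Finset.insert_subset_iff, Finset.singleton_subset_iff]
  refine ⟨one_mem_mirimanoffSupport (by omega) t0 t1 t2,
    two_mem_mirimanoffSupport (by omega) t0 t1 t2 fun h2 => ?_,
    three_mem_mirimanoffSupport (by omega) t0 t1 t2 fun h3 => ?_⟩
  · refine h12 (mul_right_cancel₀ t0 ?_)
    linear_combination -h2 - hwt
  · refine mul_ne_zero hq (pow_ne_zero 2 t0) ?_
    linear_combination h3 + (-w * t + (1 - t) ^ 2 + 60 * t) * hwt

theorem IsFirstCaseSolution.exists_perm (hp : 5 < p) {x y z : ℤ}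
    (h : IsFirstCaseSolution p x y z) :
    ∃ x' y' z' : ℤ, [x', y', z'].Perm [x, y, z] ∧ IsFirstCaseSolution p x' y' z' ∧
      (x' : ZMod p) ≠ (y' : ZMod p) ∧
      {1, 2, 3} ⊆ mirimanoffSupport p (-(x' : ZMod p) / (y' : ZMod p)) := by
  have hx := h.cast_ne_zero
  have hy := h.rotate.cast_ne_zero
  have hz := h.rotate.rotate.cast_ne_zero
  have hp' := h.ten_lt hp
  let w : Fin 3 → ZMod p :=
    ![(x : ZMod p) ^ 2 / (y * z), (y : ZMod p) ^ 2 / (z * x), (z : ZMod p) ^ 2 / (x * y)]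
  have hs : w 0 + w 1 + w 2 = 3 := by
    have hz' : (z : ZMod p) = -x - y := by linear_combination h.cast_add_eq_zero
    change (x : ZMod p) ^ 2 / (y * z) + (y : ZMod p) ^ 2 / (z * x) + (z : ZMod p) ^ 2 / (x * y) = 3
    field_simp
    rw [hz']
    ring
  have hm : w 0 * w 1 * w 2 = 1 := by
    change (x : ZMod p) ^ 2 / (y * z) * ((y : ZMod p) ^ 2 / (z * x)) *
      ((z : ZMod p) ^ 2 / (x * y)) = 1
    field_simp
  have hex : p ∉ ({11, 23, 43, 113, 223, 1609} : Finset ℕ) := fun hmem =>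
    h.notMem_exceptional hp (by
      revert hmem
      simp only [Finset.mem_insert, Finset.mem_singleton]
      tauto)
  obtain ⟨i, h4, h12, hq⟩ := exists_avoid_of_sum_eq_three_of_prod_eq_one (by omega) hex hs hm
  fin_cases i
  · exact ⟨y, z, x, by grind, h.rotate,
      h.rotate.subset_mirimanoffSupport hp' rfl h4 h12 hq⟩
  · exact ⟨z, x, y, by grind, h.rotate.rotate,
      h.rotate.rotate.subset_mirimanoffSupport hp' rfl h4 h12 hq⟩
  · exact ⟨x, y, z, .refl _, h, h.subset_mirimanoffSupport hp' rfl h4 h12 hq⟩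

theorem firstCaseHolds_of_recipSum_ne_zero (hp : 5 < p) {μ : ℕ} (hμ : μ ∈ ({3, 5, 7} : Set ℕ))
    {d : ℕ} (hd : 1 ≤ d) (hd' : d + 1 < p) (hne : recipSum p μ (blockUnion p d) ≠ 0) :
    FirstCaseHolds p := by
  intro x y z h
  obtain ⟨x', y', z', -, h', -, hsub⟩ := h.exists_perm hp
  refine hne ?_
  rcases hμ with rfl | rfl | rfl
  · exact h'.recipSum_eq_zero (by omega) (m := 1) (hsub (by simp)) hd hd'
  · exact h'.recipSum_eq_zero (by omega) (m := 2) (hsub (by simp)) hd hd'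
  · exact h'.recipSum_eq_zero (by omega) (m := 3) (hsub (by simp)) hd hd'

end FirstCase

theorem theoremt05101 (p : ℕ) [Fact p.Prime] (hp : 5 < p) :
    -- criteria with two parameters
    (∀ μ ∈ ({3, 5, 7} : Set ℕ), ∀ d₁ d₂ : ℕ, 1 ≤ d₁ → d₁ < d₂ → d₂ ≤ p - 2 →
      (∑ l ∈ Finset.Icc 1 d₁, ∑ m ∈ Finset.Icc 1 d₂, recipSum p μ (block p d₁ l ∩ block p d₂ m)) =
        recipSum p μ (⋃ l ∈ Set.Icc 1 d₁, ⋃ m ∈ Set.Icc 1 d₂, block p d₁ l ∩ block p d₂ m) ∧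
      (recipSum p μ (⋃ l ∈ Set.Icc 1 d₁, ⋃ m ∈ Set.Icc 1 d₂, block p d₁ l ∩ block p d₂ m) ≠ 0 →
        FirstCaseHolds p)) ∧
    -- criteria with one parameter
    (∀ μ ∈ ({3, 5, 7} : Set ℕ), ∀ d : ℕ, 1 ≤ d → d ≤ p - 2 →
      recipSum p μ (⋃ l ∈ Set.Icc 1 d, block p d l) ≠ 0 → FirstCaseHolds p) ∧
    -- for `d = 1` and `μ = 3` the sum is minus that of Cauchy's criterion
    recipSum p 3 (⋃ l ∈ Set.Icc 1 1, block p 1 l) =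
      -∑ j ∈ Finset.Icc 1 ((p - 1) / 2), ((j : ZMod p) ^ 3)⁻¹ ∧
    -- consequences of the failure of the first case, in terms of `t ≡ -x / y mod p`
    (∀ x y z : ℤ, IsFirstCaseSolution p x y z →
      ((x : ZMod p) ≠ (y : ZMod p) →
        1 ∈ mirimanoffSupport p (-(x : ZMod p) / (y : ZMod p)) ∧
        3 ≤ (mirimanoffSupport p (-(x : ZMod p) / (y : ZMod p))).card ∧
        (mirimanoffSupport p (-(x : ZMod p) / (y : ZMod p))).card ≤ cyclotomicClassGroupRank p ∧
        ∀ m ∈ mirimanoffSupport p (-(x : ZMod p) / (y : ZMod p)), ∀ d : ℕ, 1 ≤ d → d ≤ p - 2 →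
          recipSum p (2 * m + 1) (⋃ l ∈ Set.Icc 1 d, block p d l) = 0) ∧
      ∃ x' y' z' : ℤ, [x', y', z'].Perm [x, y, z] ∧ (x' : ZMod p) ≠ (y' : ZMod p) ∧
        {1, 2, 3} ⊆ mirimanoffSupport p (-(x' : ZMod p) / (y' : ZMod p))) := by
  have hodd : ∀ μ ∈ ({3, 5, 7} : Set ℕ), Odd μ := by
    rintro μ (rfl | rfl | rfl) <;> decide
  refine ⟨fun μ hμ d₁ d₂ h₁ h₁₂ h₂ => ⟨sum_recipSum_inter_eq μ d₁ d₂, fun hne => ?_⟩,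
    fun μ hμ d hd hd' hne => firstCaseHolds_of_recipSum_ne_zero hp hμ hd (by omega) hne,
    recipSum_blockUnion_one (by omega) (by decide), fun x y z h => ⟨fun hxy => ?_, ?_⟩⟩
  · rw [iUnion_block_inter] at hne
    have key := two_mul_recipSum_inter (p := p) (by omega) (hodd μ hμ) h₁ (by omega)
      (h₁.trans h₁₂.le) (by omega)
    by_cases h0 : recipSum p μ (blockUnion p d₁) = 0
    · refine firstCaseHolds_of_recipSum_ne_zero hp hμ (d := d₂) (by omega) (by omega) fun h0' => ?_
      rw [h0, h0', add_zero] at key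
      exact mul_ne_zero (two_zmod_ne_zero (by omega)) hne key
    · exact firstCaseHolds_of_recipSum_ne_zero hp hμ h₁ (by omega) h0
  · obtain ⟨h0, h1, h2⟩ := h.ratio_ne hxy
    refine ⟨one_mem_mirimanoffSupport hp h0 h1 h2, three_le_card_mirimanoffSupport (h.ten_lt hp)
      (fun e => h.notMem_exceptional hp (by simp [e])) h0 h1 h2, ?_, fun m hm d hd hd' =>
      h.recipSum_eq_zero (by omega) hm hd (by omega)⟩
    obtain ⟨x', y', z', h', hcop, ht⟩ := h.exists_isCoprime
    rw [← ht]
    exact card_mirimanoffSupport_le_rank (by omega) h' hcop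
  · obtain ⟨x', y', z', hperm, -, hne, hsub⟩ := h.exists_perm hp
    exact ⟨x', y', z', hperm, hne, hsub⟩
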